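/- Let $f,g:\mathbb R^{d_x}\times\mathbb R^{d_y}\to\mathbb R$, and consider the bilevel problem $\min_{x,\,y\in S(x)} f(x,y)$, where $S(x)=\arg\min_y g(x,y)$ and $g^*(x)=\inf_y g(x,y)$. Let $\ell_{f,0},\ell_{f,1},\ell_{g,1},\ell_{g,2}\ge 0$ and $\mu_g,\lambda_g>0$, and assume: (A1) $f$ is differentiable, $g$ is twice differentiable, $\nabla f,\nabla g,\nabla^2 g$ are Lipschitz continuous in $(x,y)$ with constants $\ell_{f,1},\ell_{g,1},\ell_{g,2}$, and $f(x,\cdot)$ is $\ell_{f,0}$-Lipschitz for every $x$. (A2) $g^*$ is finite, $\|\nabla_y g(x,y)\|^2\ge 2\mu_g\,(g(x,y)-g^*(x))$ for all $x,y$, and every nonzero singular value of every $\nabla^2_{yy}g(x,y)$ is at least $\lambda_g$. (A3) The bilevel problem is bounded below: $f(x,y)\ge \underline f>-\infty$ for all $x$ and all $y\in S(x)$. The algorithm GALET with step sizes $\alpha,\beta,\rho>0$ and inner loop lengths $N\ge1$, $T\ge 0$ starts from $(x^0,y^0,w^0)$ and, for $k=0,1,\dots$, does the following: - $y^{k+1}=y^{k,N}$,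 where $y^{k,0}=y^k$ and $y^{k,n+1}=y^{k,n}-\beta\nabla_y g(x^k,y^{k,n})$; - $w^{k+1}=w^{k,T}$, where $w^{k,0}=0$ and $w^{k,t+1}=w^{k,t}-\rho\,\nabla^2_{yy}g(x^k,y^{k+1})\big(\nabla_yf(x^k,y^{k+1})+\nabla^2_{yy}g(x^k,y^{k+1})w^{k,t}\big)$; - $x^{k+1}=x^k-\alpha\big(\nabla_xf(x^k,y^{k+1})+\nabla^2_{xy}g(x^k,y^{k+1})w^{k+1}\big)$. Define $$\mathcal R_x(x,y,w)=\|\nabla_xf(x,y)+\nabla^2_{xy}g(x,y)w\|^2,\qquad \mathcal R_w(x,y,w)=\|\nabla^2_{yy}g(x,y)(\nabla_yf(x,y)+\nabla^2_{yy}g(x,y)w)\|^2,\qquad \mathcal R_y(x,y)=g(x,y)-g^*(x).$$ A point $(x,y)$ is called $\epsilon$-stationary if for some $w$ all three of $\mathcal R_x(x,y,w)$, $\mathcal R_w(x,y,w)$, $\mathcal R_y(x,y)$ are at most $\epsilon$. Theorem. For every $N\ge1$ there are constants $\bar\beta,\kappa,\bar\rho>0$, depending only on $N,\ell_{f,0},\ell_{f,1},\ell_{g,1},\ell_{g,2},\mu_g,\lambda_g$,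 such that for all constant step sizes $0<\beta\le\bar\beta$, $0<\alpha\le\kappa\beta$, $0<\rho\le\bar\rho$ there is $\bar c>0$, depending only on these constants and the step sizes, such that for every $c\ge\bar c$ and every $D\in\mathbb R$ there is $C>0$, depending only on all of these, with the following property. Let $d_x,d_y,f,g,\underline f$ satisfy (A1)–(A3), let $f(x^0,y^0)-\underline f\le D$, and let $\mathcal R_x(x^0,y^0,w^0)$, $\mathcal R_w(x^0,y^0,w^0)$, $\mathcal R_y(x^0,y^0)$ all be at most $D$. Run GALET with $T=T(K)=\lceil c\log K\rceil$. Then: 1. For every $K\ge1$, $$\frac1K\sum_{k=0}^{K-1}\mathcal R_x(x^k,y^k,w^k)\le\frac CK,\qquad \frac1K\sum_{k=0}^{K-1}\mathcal R_w(x^k,y^k,w^k)\le\frac CK,\qquad \frac1K\sum_{k=0}^{K-1}\mathcal R_y(x^k,y^k)\le\frac CK.$$ 2. For every $\epsilon\in(0,1/2]$ there is $K\ge1$ such that the run with $K$ outer iterations uses $K(N+T(K)+1)\le C\,\epsilon^{-1}\log(\epsilon^{-1})$ steps in total (counting every $y$-, $w$- and $x$-update), and some $(x^k,y^k)$ with $k<K$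 is $\epsilon$-stationary. That is, the iteration complexity is $\tilde{\mathcal O}(\epsilon^{-1})$. -/

import Mathlib

open scoped NNReal Gradient

noncomputable section

namespace Galet

/-- Euclidean space of dimension `d`. -/
abbrev E (d : ℕ) := EuclideanSpace ℝ (Fin d)

variable {dx dy : ℕ}

/-- A function of two variables seen as a function on the Euclidean (ℓ²) product. -/
def joint (h : E dx → E dy → ℝ) : WithLp 2 (E dx × E dy) → ℝ :=
  fun p => h p.fst p.snd

/-- Partial gradient in `x`. -/
def gradX (h : E dx → E dy → ℝ) (x : E dx) (y : E dy) : E dx :=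
  ∇ (fun x' => h x' y) x

/-- Partial gradient in `y`. -/
def gradY (h : E dx → E dy → ℝ) (x : E dx) (y : E dy) : E dy :=
  ∇ (fun y' => h x y') y

/-- The Hessian block `∇²_yy h (x, y)`. -/
def hessYY (h : E dx → E dy → ℝ) (x : E dx) (y : E dy) : E dy →L[ℝ] E dy :=
  fderiv ℝ (fun y' => gradY h x y') y

/-- The mixed block `∇²_xy h (x, y)`, a `dx × dy` matrix: the `y`-derivative of `∇_x h`. -/
def hessXY (h : E dx → E dy → ℝ) (x : E dx) (y : E dy) : E dy →L[ℝ] E dx :=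
  fderiv ℝ (fun y' => gradX h x y') y

/-- The value function `g*(x)` of the lower-level problem. -/
def valueFn (g : E dx → E dy → ℝ) (x : E dx) : ℝ := ⨅ y, g x y

/-- The lower-level solution set `S(x)`. -/
def solSet (g : E dx → E dy → ℝ) (x : E dx) : Set (E dy) :=
  {y | ∀ y', g x y ≤ g x y'}

/-- Smoothness assumptions: `∇f`, `∇g`, `∇²g` are Lipschitz on the joint space with constants
`lf1`, `lg1`, `lg2` (operator norm for `∇²g`), and each `f(x, ·)` is `lf0`-Lipschitz. -/
structure LipschitzAssumption (lf0 lf1 lg1 lg2 : ℝ≥0) (f g : E dx → E dy → ℝ) : Prop where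
  diff_f : Differentiable ℝ (joint f)
  diff_g : Differentiable ℝ (joint g)
  diff_grad_g : Differentiable ℝ (∇ (joint g))
  lip_grad_f : LipschitzWith lf1 (∇ (joint f))
  lip_grad_g : LipschitzWith lg1 (∇ (joint g))
  lip_hess_g : LipschitzWith lg2 (fderiv ℝ (∇ (joint g)))
  lip_f : ∀ x, LipschitzWith lf0 (f x)

/-- The lower-level objective has a finite value function, is `mu`-PL in `y`, and all nonzero
singular values of `∇²_yy g` are at least `lam`. -/
structure PLAssumption (mu lam : ℝ) (g : E dx → E dy → ℝ) : Prop where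
  bddBelow : ∀ x, BddBelow (Set.range (g x))
  pl : ∀ x y, 2 * mu * (g x y - valueFn g x) ≤ ‖gradY g x y‖ ^ 2
  singular : ∀ x y (i : ℕ),
    (hessYY g x y : E dy →ₗ[ℝ] E dy).singularValues i ≠ 0 →
      lam ≤ (hessYY g x y : E dy →ₗ[ℝ] E dy).singularValues i

/-- `R_x(x, y, w) = ‖∇_x f + ∇²_xy g w‖²`. -/
def resX (f g : E dx → E dy → ℝ) (x : E dx) (y w : E dy) : ℝ :=
  ‖gradX f x y + hessXY g x y w‖ ^ 2

/-- `R_w(x, y, w) = ‖∇²_yy g (∇_y f + ∇²_yy g w)‖²`. -/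
def resW (f g : E dx → E dy → ℝ) (x : E dx) (y w : E dy) : ℝ :=
  ‖hessYY g x y (gradY f x y + hessYY g x y w)‖ ^ 2

/-- `R_y(x, y) = g(x, y) - g*(x)`. -/
def resY (g : E dx → E dy → ℝ) (x : E dx) (y : E dy) : ℝ :=
  g x y - valueFn g x

/-- `(x, y)` is an `ε`-stationary point of the bilevel problem. -/
def IsEpsStationary (f g : E dx → E dy → ℝ) (ε : ℝ) (x : E dx) (y : E dy) : Prop :=
  ∃ w : E dy, resX f g x y w ≤ ε ∧ resW f g x y w ≤ ε ∧ resY g x y ≤ ε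

/-- `N` gradient steps of size `β` on `g(x, ·)` from `y`. -/
def innerY (g : E dx → E dy → ℝ) (β : ℝ) (N : ℕ) (x : E dx) (y : E dy) : E dy :=
  (fun v => v - β • gradY g x v)^[N] y

/-- `T` steps of size `ρ` from `0` on `w ↦ ½‖∇_y f(x, y) + ∇²_yy g(x, y) w‖²`. -/
def innerW (f g : E dx → E dy → ℝ) (ρ : ℝ) (T : ℕ) (x : E dx) (y : E dy) : E dy :=
  (fun w => w - ρ • hessYY g x y (gradY f x y + hessYY g x y w))^[T] 0

/-- An iterate `(x^k, y^k, w^k)`. -/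
structure State (dx dy : ℕ) where
  x : E dx
  y : E dy
  w : E dy

/-- One outer iteration of GALET: first `y`, then `w`, then `x`. -/
def step (f g : E dx → E dy → ℝ) (α β ρ : ℝ) (N T : ℕ) (s : State dx dy) : State dx dy :=
  let y' := innerY g β N s.x s.y
  let w' := innerW f g ρ T s.x y'
  { x := s.x - α • (gradX f s.x y' + hessXY g s.x y' w')
    y := y'
    w := w' }

/-- The GALET iterates from the initial state `s₀`; `w^0` only enters the `k = 0` residuals. -/
def iter (f g : E dx → E dy → ℝ) (α β ρ : ℝ) (N T : ℕ) (s₀ : State dx dy) (k : ℕ) :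
    State dx dy :=
  (step f g α β ρ N T)^[k] s₀

/-- The number `T = ⌈c log K⌉` of inner `w`-steps when `K` outer iterations are run. -/
def innerSteps (c : ℝ) (K : ℕ) : ℕ := ⌈c * Real.log K⌉₊

end Galet

end

/-! The value f(x, y) need not decrease: a lower-level gradient step can raise it to first order. It
is therefore corrected. With H = ∇²_yy g and w† = -H†∇_y f, put F = f + ⟨w†, ∇_y g⟩. Formally, the
y-gradient of F is ∇_y f + Hw† up to O(‖∇_y g‖), and this vector lies in ker H. The PL error bound
and a Taylor expansion at a nearby minimizer show that ∇_y g lies in the range of H up to O(‖∇_y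
g‖²), so the two are almost orthogonal (`abs_inner_gradY_add_le`). A y-step of size β thus raises F
by only O(β‖∇_y g‖²), and a large multiple of g - g* pays for that. The x-gradient of F is ∇_x f +
∇²_xy g w† up to O(‖∇_y g‖), which is the direction used by the algorithm except that w replaces w†.

Hence F + 64M⁷(g - g*) drops in each outer iteration by multiples of ‖d‖² (d the x-direction) and
‖∇_y g‖², up to an error O(α‖w - w†‖²) (`lyapunov_outer_le`), and it is bounded below
(`le_lyapunov`). The w-loop started at 0 converges linearly to w†, so c log K steps keep the sum of
the errors over K iterations bounded. Telescoping bounds the sums of the residuals independently of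
K (`sum_residuals_le`).

The argument needs w† to be Lipschitz although H may be singular. The lower bound on nonzero
singular values bounds H† uniformly, and uniformly bounded pseudoinverses depend on H in a Lipschitz
way (`IsPseudoinverse.norm_sub_le`). -/

noncomputable section

namespace Galet

/-! ### Pseudoinverses: existence, Lipschitz dependence, and gradient descent for singular linear
systems. -/

section LinearAlgebra

variable {V : Type*} [NormedAddCommGroup V] [InnerProductSpace ℝ V]

/-- `P` is the group inverse of `T`; for symmetric `T` it is the Moore-Penrose inverse. -/
structure IsPseudoinverse (T P : V →L[ℝ] V) : Prop where
  mul_inv_mul : T * P * T = T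
  inv_mul_inv : P * T * P = P
  comm : T * P = P * T

theorem le_abs_eigenvalue_of_singularValues [FiniteDimensional ℝ V]
    {T : V →ₗ[ℝ] V} (hT : T.IsSymmetric) {lam : ℝ}
    (h : ∀ i : ℕ, T.singularValues i ≠ 0 → lam ≤ T.singularValues i)
    {m : ℝ} (hm : m ≠ 0) {v : V} (hv : v ≠ 0) (hTv : T v = m • v) : lam ≤ |m| := by
  have hadj : T.adjoint = T := (LinearMap.isSymmetric_iff_isSelfAdjoint T).1 hT
  have hev : Module.End.HasEigenvalue (T.adjoint ∘ₗ T) (m ^ 2) := by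
    apply Module.End.hasEigenvalue_of_hasEigenvector (x := v)
    refine ⟨Module.End.mem_eigenspace_iff.2 ?_, hv⟩
    rw [hadj, LinearMap.comp_apply, hTv, map_smul, hTv, smul_smul, pow_two]
  obtain ⟨i, hi⟩ := T.isSymmetric_adjoint_comp_self.exists_eigenvalues_eq rfl hev
  have hs : T.singularValues i = |m| := by
    rw [T.singularValues_fin rfl, ← Real.sqrt_sq_eq_abs]
    exact congrArg Real.sqrt hi
  rw [← hs]
  exact h i (by rw [hs]; exact abs_ne_zero.2 hm)

/-- Invert the eigenvalues in an orthonormal eigenbasis; the convention 0⁻¹ = 0 handles the kernel.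
-/
theorem exists_isPseudoinverse [FiniteDimensional ℝ V] (T : V →L[ℝ] V)
    (hT : (T : V →ₗ[ℝ] V).IsSymmetric) {lam : ℝ} (hlam : 0 < lam)
    (h : ∀ i : ℕ, (T : V →ₗ[ℝ] V).singularValues i ≠ 0 →
      lam ≤ (T : V →ₗ[ℝ] V).singularValues i) :
    ∃ P : V →L[ℝ] V, IsPseudoinverse T P ∧ ‖P‖ ≤ lam⁻¹ := by
  set b := hT.eigenvectorBasis rfl
  set e := hT.eigenvalues rfl
  have hTb : ∀ i, T (b i) = e i • b i := fun i => hT.apply_eigenvectorBasis rfl i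
  have he : ∀ i, |(e i)⁻¹| ≤ lam⁻¹ := by
    intro i
    rw [abs_inv]
    rcases eq_or_ne (e i) 0 with h0 | h0
    · simp [h0, hlam.le]
    · exact inv_anti₀ hlam (le_abs_eigenvalue_of_singularValues hT h h0
        (b.orthonormal.ne_zero i) (hTb i))
  let P : V →L[ℝ] V := LinearMap.toContinuousLinearMap
    (b.toBasis.constr ℝ fun i => (e i)⁻¹ • b i)
  have hPb : ∀ i, P (b i) = (e i)⁻¹ • b i := by
    intro i
    have := b.toBasis.constr_basis ℝ (fun i => (e i)⁻¹ • b i) i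
    rwa [OrthonormalBasis.coe_toBasis] at this
  have hext : ∀ A B : V →L[ℝ] V, (∀ i, A (b i) = B (b i)) → A = B := by
    intro A B hAB
    apply ContinuousLinearMap.coe_injective
    exact b.toBasis.ext (by simpa using hAB)
  refine ⟨P, ⟨hext _ _ fun i => ?_, hext _ _ fun i => ?_, hext _ _ fun i => ?_⟩, ?_⟩
  · rcases eq_or_ne (e i) 0 with h0 | h0 <;> simp [hTb, hPb, smul_smul, h0]
  · rcases eq_or_ne (e i) 0 with h0 | h0 <;> simp [hTb, hPb, smul_smul, h0]
  · simp [hTb, hPb, smul_smul, mul_comm]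
  · refine P.opNorm_le_bound (by positivity) fun v => ?_
    have hsum : P v = ∑ i, ((e i)⁻¹ * inner ℝ (b i) v) • b i := by
      conv_lhs => rw [← b.sum_repr' v]
      simp [hPb, smul_smul, mul_comm]
    have hn : ‖P v‖ ^ 2 ≤ (lam⁻¹ * ‖v‖) ^ 2 := by
      rw [mul_pow, ← b.sum_sq_norm_inner_right (P v), ← b.sum_sq_norm_inner_right v, Finset.mul_sum]
      refine Finset.sum_le_sum fun i _ => ?_
      rw [hsum, b.orthonormal.inner_right_fintype, norm_mul, mul_pow]
      gcongr
      exact he i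
    exact le_of_sq_le_sq hn (by positivity)

/-- Pseudoinversion is discontinuous where the rank jumps, but there the pseudoinverse blows up; the
common bound on `P` and `Q` excludes this. -/
theorem IsPseudoinverse.norm_sub_le {A B P Q : V →L[ℝ] V} (hA : IsPseudoinverse A P)
    (hB : IsPseudoinverse B Q) {M : ℝ} (hM : 1 ≤ M) (hAM : ‖A‖ ≤ M) (hBM : ‖B‖ ≤ M) (hP : ‖P‖ ≤ M)
    (hQ : ‖Q‖ ≤ M) : ‖P - Q‖ ≤ 5 * M ^ 4 * ‖A - B‖ := by
  have h1 : P * P * A = P := by rw [mul_assoc, ← hA.comm, ← mul_assoc, hA.inv_mul_inv]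
  have h2 : B * Q * Q = Q := by rw [hB.comm, hB.inv_mul_inv]
  have h3 : P * A * A = A := by rw [← hA.comm, hA.mul_inv_mul]
  have h4 : B * (B * Q) = B := by rw [hB.comm, ← mul_assoc, hB.mul_inv_mul]
  -- A Wedin-type identity: the first term is the resolvent identity for invertible operators, the
  -- other two account for the kernels. Every term is linear in `A - B`.
  have key : P - Q = -(P * (A - B) * Q) + P * P * (A - B) * (1 - B * Q)
      + (1 - P * A) * (A - B) * (Q * Q) := by
    have e1 : P * P * (A - B) * (1 - B * Q) = P - P * B * Q := by
      have : P * P * (A - B) * (1 - B * Q)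
          = P * P * A - (P * P * A) * B * Q - P * P * (B - B * (B * Q)) := by noncomm_ring
      rw [this, h1, h4]; noncomm_ring
    have e2 : (1 - P * A) * (A - B) * (Q * Q) = P * A * Q - Q := by
      have : (1 - P * A) * (A - B) * (Q * Q)
          = (A - P * A * A) * Q * Q - (B * Q * Q) + P * A * (B * Q * Q) := by noncomm_ring
      rw [this, h3, h2]; noncomm_ring
    rw [e1, e2]; noncomm_ring
  have hone : ‖(1 : V →L[ℝ] V)‖ ≤ 1 := ContinuousLinearMap.norm_id_le
  have hMM : (1 : ℝ) ≤ M * M := by nlinarith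
  have b1 : ‖1 - B * Q‖ ≤ 2 * M ^ 2 := by
    calc ‖1 - B * Q‖ ≤ ‖(1 : V →L[ℝ] V)‖ + ‖B * Q‖ := _root_.norm_sub_le _ _
      _ ≤ 1 + ‖B‖ * ‖Q‖ := by gcongr; exact norm_mul_le _ _
      _ ≤ 1 + M * M := by gcongr
      _ ≤ 2 * M ^ 2 := by nlinarith
  have b2 : ‖1 - P * A‖ ≤ 2 * M ^ 2 := by
    calc ‖1 - P * A‖ ≤ ‖(1 : V →L[ℝ] V)‖ + ‖P * A‖ := _root_.norm_sub_le _ _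
      _ ≤ 1 + ‖P‖ * ‖A‖ := by gcongr; exact norm_mul_le _ _
      _ ≤ 1 + M * M := by gcongr
      _ ≤ 2 * M ^ 2 := by nlinarith
  rw [key]
  have hM2 : M * M ≤ M ^ 4 := by nlinarith [mul_self_nonneg M]
  calc _ ≤ ‖P‖ * ‖A - B‖ * ‖Q‖ + ‖P‖ * ‖P‖ * ‖A - B‖ * ‖1 - B * Q‖
          + ‖1 - P * A‖ * ‖A - B‖ * (‖Q‖ * ‖Q‖) := by
        refine (norm_add_le _ _).trans (add_le_add ((norm_add_le _ _).trans (add_le_add ?_ ?_)) ?_)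
        · rw [norm_neg]
          exact (norm_mul_le _ _).trans (by gcongr; exact norm_mul_le _ _)
        · exact (norm_mul_le _ _).trans (by
            gcongr; exact (norm_mul_le _ _).trans (by gcongr; exact norm_mul_le _ _))
        · exact (norm_mul_le _ _).trans (by gcongr <;> exact norm_mul_le _ _)
    _ ≤ M * ‖A - B‖ * M + M * M * ‖A - B‖ * (2 * M ^ 2) + 2 * M ^ 2 * ‖A - B‖ * (M * M) := by
        gcongr
    _ = (M * M + 4 * M ^ 4) * ‖A - B‖ := by ring
    _ ≤ 5 * M ^ 4 * ‖A - B‖ := by gcongr; linarith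

/-- Gradient steps for `w ↦ ½‖q + T w‖²` started at `0` converge linearly to `-P q`. -/
theorem IsPseudoinverse.norm_sq_iterate_add_le {T P : V →L[ℝ] V} (h : IsPseudoinverse T P)
    (hT : (T : V →ₗ[ℝ] V).IsSymmetric) {M ρ : ℝ} (hM : 1 ≤ M) (hTM : ‖T‖ ≤ M) (hPM : ‖P‖ ≤ M)
    (hρ : 0 < ρ) (hρM : ρ * M ^ 2 ≤ 1) (q : V) (t : ℕ) :
    ‖(fun w => w - ρ • T (q + T w))^[t] 0 + P q‖ ^ 2
      ≤ Real.exp (-(ρ / M ^ 2 * t)) * ‖P q‖ ^ 2 := by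
  have hMp : 0 < M := by linarith
  have hPT : ∀ v, P (T (P v)) = P v := fun v => congrArg (· v) h.inv_mul_inv
  have hTPT : ∀ v, T (P (T v)) = T v := fun v => congrArg (· v) h.mul_inv_mul
  have hc : ∀ v, T (P v) = P (T v) := fun v => congrArg (· v) h.comm
  have hTT : ∀ v, T (T (P v)) = T v := fun v => by rw [hc, hTPT]
  -- The induction also carries that the error is fixed by `P * T`, hence lies in the range of `T`.
  -- There ‖u‖ ≤ M‖Tu‖, so u ↦ u - ρT²u contracts; on the kernel it would not. Starting at 0 is what
  -- puts the error in the range.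
  suffices hs : P (T ((fun w => w - ρ • T (q + T w))^[t] 0 + P q))
        = (fun w => w - ρ • T (q + T w))^[t] 0 + P q ∧
      ‖(fun w => w - ρ • T (q + T w))^[t] 0 + P q‖ ^ 2
        ≤ Real.exp (-(ρ / M ^ 2 * t)) * ‖P q‖ ^ 2 from hs.2
  induction t with
  | zero => simp [hPT]
  | succ t ih =>
    obtain ⟨ih1, ih2⟩ := ih
    rw [Function.iterate_succ_apply']
    set w := (fun w => w - ρ • T (q + T w))^[t] 0
    set u := w + P q with hu
    have hnext : w - ρ • T (q + T w) + P q = u - ρ • T (T u) := by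
      have : T (q + T w) = T (T u) := by
        rw [hu, map_add, map_add, map_add, hTT, add_comm]
      rw [this, hu]; abel
    rw [hnext]
    refine ⟨?_, ?_⟩
    · rw [map_sub, map_sub, map_smul, map_smul, ih1, ← hc (T (T u)), hTPT]
    · have hTu : ‖u‖ ≤ M * ‖T u‖ := by
        calc ‖u‖ = ‖P (T u)‖ := by rw [ih1]
          _ ≤ ‖P‖ * ‖T u‖ := P.le_opNorm _
          _ ≤ M * ‖T u‖ := by gcongr
      have hTTu : ‖T (T u)‖ ≤ M * ‖T u‖ := (T.le_opNorm _).trans (by gcongr)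
      have hinner : inner ℝ u (T (T u)) = ‖T u‖ ^ 2 := by
        rw [← real_inner_self_eq_norm_sq]; exact (hT u (T u)).symm
      have h1 : ‖u - ρ • T (T u)‖ ^ 2 ≤ (1 - ρ / M ^ 2) * ‖u‖ ^ 2 := by
        rw [norm_sub_sq_real, inner_smul_right, hinner, norm_smul, Real.norm_of_nonneg hρ.le]
        have a1 : ‖T (T u)‖ ^ 2 ≤ M ^ 2 * ‖T u‖ ^ 2 := by
          rw [← mul_pow]; gcongr
        have a2 : ‖u‖ ^ 2 / M ^ 2 ≤ ‖T u‖ ^ 2 := by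
          rw [div_le_iff₀ (by positivity), ← mul_pow, mul_comm]; gcongr
        have a3 : ρ ^ 2 * ‖T (T u)‖ ^ 2 ≤ ρ * ‖T u‖ ^ 2 := by
          calc ρ ^ 2 * ‖T (T u)‖ ^ 2 ≤ ρ ^ 2 * (M ^ 2 * ‖T u‖ ^ 2) := by gcongr
            _ = (ρ * M ^ 2) * (ρ * ‖T u‖ ^ 2) := by ring
            _ ≤ 1 * (ρ * ‖T u‖ ^ 2) := by gcongr
            _ = _ := one_mul _
        have a4 : ρ * (‖u‖ ^ 2 / M ^ 2) ≤ ρ * ‖T u‖ ^ 2 := by gcongr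
        have a5 : ρ / M ^ 2 * ‖u‖ ^ 2 = ρ * (‖u‖ ^ 2 / M ^ 2) := by ring
        rw [mul_pow, sub_mul, a5]; linarith
      have h2 : 1 - ρ / M ^ 2 ≤ Real.exp (-(ρ / M ^ 2)) := by
        have := Real.add_one_le_exp (-(ρ / M ^ 2)); linarith
      calc _ ≤ (1 - ρ / M ^ 2) * ‖u‖ ^ 2 := h1
        _ ≤ Real.exp (-(ρ / M ^ 2)) * (Real.exp (-(ρ / M ^ 2 * t)) * ‖P q‖ ^ 2) := by gcongr
        _ = _ := by rw [← mul_assoc, ← Real.exp_add]; push_cast; ring_nf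

end LinearAlgebra

/-! ### Taylor bounds, gradient steps, and the error bound from the PL inequality. -/

section Analysis

/-- The mean value inequality gives `L` rather than L/2, whence the quadratic terms without a factor
1/2 later on. -/
theorem norm_sub_sub_fderiv_le {V W : Type*} [NormedAddCommGroup V] [NormedSpace ℝ V]
    [NormedAddCommGroup W] [NormedSpace ℝ W] {F : V → W} {L : ℝ≥0} (hF : Differentiable ℝ F)
    (hL : LipschitzWith L (fderiv ℝ F)) (u v : V) :
    ‖F v - F u - fderiv ℝ F u (v - u)‖ ≤ L * ‖v - u‖ ^ 2 := by
  have := (convex_segment u v).norm_image_sub_le_of_norm_fderiv_le' (f := F) (𝕜 := ℝ)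
    (φ := fderiv ℝ F u) (C := L * ‖v - u‖) (fun x _ => hF x) (fun x hx => ?_)
    (left_mem_segment ℝ u v) (right_mem_segment ℝ u v)
  · rwa [mul_assoc, ← pow_two] at this
  · refine (hL.norm_sub_le x u).trans ?_
    gcongr
    exact norm_sub_le_of_mem_segment hx

variable {V : Type*} [NormedAddCommGroup V] [InnerProductSpace ℝ V]

theorem gradient_step_le {h : V → ℝ} {G : V → V} {M β : ℝ} (hβ : 0 < β) (hβM : 2 * M * β ≤ 1)
    (hdesc : ∀ u v, h v ≤ h u + inner ℝ (G u) (v - u) + M * ‖v - u‖ ^ 2) (u : V) :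
    h (u - β • G u) ≤ h u - β / 2 * ‖G u‖ ^ 2 := by
  have := hdesc u (u - β • G u)
  rw [sub_sub_cancel_left, inner_neg_right, inner_smul_right, real_inner_self_eq_norm_sq, norm_neg,
    norm_smul, Real.norm_of_nonneg hβ.le] at this
  have h2 : (2 * M * β) * (β * ‖G u‖ ^ 2) ≤ 1 * (β * ‖G u‖ ^ 2) := by gcongr
  nlinarith

/-- One gradient step of length 1/(2M) cannot go below the infimum. -/
theorem norm_sq_gradient_le {h : V → ℝ} {G : V → V} {M : ℝ} (hM : 0 < M)
    (hdesc : ∀ u v, h v ≤ h u + inner ℝ (G u) (v - u) + M * ‖v - u‖ ^ 2)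
    (hbdd : BddBelow (Set.range h)) (u : V) : ‖G u‖ ^ 2 ≤ 4 * M * (h u - ⨅ v, h v) := by
  have h1 := gradient_step_le (β := 1 / (2 * M)) (by positivity)
    (by rw [mul_one_div_cancel (by positivity)]) hdesc u
  have h2 := ciInf_le hbdd (u - (1 / (2 * M)) • G u)
  have h3 : 1 / (2 * M) / 2 * ‖G u‖ ^ 2 ≤ h u - ⨅ v, h v := by linarith
  have h4 : 4 * M * (1 / (2 * M) / 2 * ‖G u‖ ^ 2) = ‖G u‖ ^ 2 := by field_simp; norm_num
  rw [← h4]; gcongr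

variable [CompleteSpace V]

theorem lipschitzWith_fderiv_of_gradient {F : V → ℝ} {L : ℝ≥0} (hL : LipschitzWith L (∇ F)) :
    LipschitzWith L (fderiv ℝ F) := by
  rw [← toDual_comp_gradient]
  simpa using (InnerProductSpace.toDual ℝ V).isometry.lipschitz.comp hL

theorem inner_fderiv_gradient_comm {F : V → ℝ} (hF : Differentiable ℝ F)
    (hG : Differentiable ℝ (∇ F)) (z u v : V) :
    inner ℝ (fderiv ℝ (∇ F) z u) v = inner ℝ (fderiv ℝ (∇ F) z v) u := by
  set B : V →L[ℝ] V →L[ℝ] ℝ :=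
    (isBoundedBilinearMap_inner (𝕜 := ℝ) (E := V)).toContinuousLinearMap
  have hB : fderiv ℝ F = fun y => B (∇ F y) := by
    funext y
    ext v
    exact inner_gradient_left.symm
  have h2 : HasFDerivAt (fderiv ℝ F) (B.comp (fderiv ℝ (∇ F) z)) z := by
    rw [hB]
    exact B.hasFDerivAt.comp z (hG z).hasFDerivAt
  exact second_derivative_symmetric (fun y => (hF y).hasFDerivAt) h2 u v

/-- The error bound implied by the Polyak-Łojasiewicz inequality. -/
theorem exists_isMin_of_polyakLojasiewicz {h : V → ℝ} {G : V → V} {M : ℝ} (hM : 1 ≤ M)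
    (hcont : Continuous h)
    (hdesc : ∀ u v, h v ≤ h u + inner ℝ (G u) (v - u) + M * ‖v - u‖ ^ 2)
    (hbdd : BddBelow (Set.range h)) (hpl : ∀ u, h u - ⨅ v, h v ≤ M * ‖G u‖ ^ 2) (u : V) :
    ∃ v, (∀ w, h v ≤ h w) ∧ G v = 0 ∧ ‖u - v‖ ^ 2 ≤ 64 * M ^ 4 * (h u - ⨅ v, h v) := by
  have hMp : 0 < M := by linarith
  set m := ⨅ v, h v
  have hm : ∀ v, m ≤ h v := ciInf_le hbdd
  -- A gradient step multiplies the gap by at most 1 - 1/(4M²) ≤ q². Step lengths are bounded by the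
  -- square root of the gap, so they decay like qⁿ; summing gives (1 - q)⁻¹ = 8M², the source of the
  -- constant 64M⁴.
  set q : ℝ := 1 - 1 / (8 * M ^ 2) with hq
  have hM2 : 1 / (8 * M ^ 2) ≤ 1 / 8 := by
    gcongr; nlinarith
  have hM0 : 0 < 1 / (8 * M ^ 2) := by positivity
  have hq0 : 0 ≤ q := by linarith
  have hq1 : q < 1 := by linarith
  set S : V → V := fun v => v - (1 / (2 * M)) • G v with hS
  have hstep : ∀ v, h (S v) - m ≤ q ^ 2 * (h v - m) := by
    intro v
    have h1 := gradient_step_le (β := 1 / (2 * M)) (by positivity)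
      (by rw [mul_one_div_cancel (by positivity)]) hdesc v
    have h2 : (h v - m) / M ≤ ‖G v‖ ^ 2 := by
      rw [div_le_iff₀ hMp, mul_comm]; exact hpl v
    have h3 : 1 / (2 * M) / 2 * ((h v - m) / M) ≤ 1 / (2 * M) / 2 * ‖G v‖ ^ 2 := by gcongr
    have h4 : 1 / (2 * M) / 2 * ((h v - m) / M) = 2 * (1 / (8 * M ^ 2)) * (h v - m) := by
      field_simp; ring
    have h5 : (1 - 2 * (1 / (8 * M ^ 2))) * (h v - m) ≤ q ^ 2 * (h v - m) := by
      have := hm v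
      exact mul_le_mul_of_nonneg_right (by rw [hq]; nlinarith) (by linarith)
    change h (v - (1 / (2 * M)) • G v) - m ≤ _
    linarith
  have hiter : ∀ n, h (S^[n] u) - m ≤ (q ^ n) ^ 2 * (h u - m) := by
    intro n
    induction n with
    | zero => simp
    | succ n ih =>
      rw [Function.iterate_succ_apply']
      calc _ ≤ q ^ 2 * (h (S^[n] u) - m) := hstep _
        _ ≤ q ^ 2 * ((q ^ n) ^ 2 * (h u - m)) := by gcongr
        _ = _ := by ring
  have hΔ : 0 ≤ h u - m := by linarith [hm u]
  have hdist : ∀ n, dist (S^[n] u) (S^[n + 1] u) ≤ √(h u - m) * q ^ n := by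
    intro n
    rw [Function.iterate_succ_apply', dist_eq_norm]
    have e : S^[n] u - S (S^[n] u) = (1 / (2 * M)) • G (S^[n] u) := by rw [hS]; simp
    rw [e, norm_smul, Real.norm_of_nonneg (by positivity)]
    apply le_of_sq_le_sq _ (by positivity)
    rw [mul_pow, mul_pow, Real.sq_sqrt hΔ]
    have h1 := norm_sq_gradient_le hMp hdesc hbdd (S^[n] u)
    calc (1 / (2 * M)) ^ 2 * ‖G (S^[n] u)‖ ^ 2 ≤ (1 / (2 * M)) ^ 2 * (4 * M * (h (S^[n] u) - m)) := by
          gcongr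
      _ = 1 / M * (h (S^[n] u) - m) := by field_simp; norm_num
      _ ≤ 1 * (h (S^[n] u) - m) := by
          have := hm (S^[n] u)
          exact mul_le_mul_of_nonneg_right (by rwa [div_le_one hMp]) (by linarith)
      _ ≤ _ := by rw [one_mul, mul_comm]; exact hiter n
  obtain ⟨v, hv⟩ := cauchySeq_tendsto_of_complete (cauchySeq_of_le_geometric q _ hq1 hdist)
  have hvm : h v ≤ m := by
    have h1 : Filter.Tendsto (fun n => h (S^[n] u) - m) Filter.atTop (nhds (h v - m)) :=
      ((hcont.tendsto v).comp hv).sub_const m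
    have h2 : Filter.Tendsto (fun n : ℕ => (q ^ n) ^ 2 * (h u - m)) Filter.atTop (nhds 0) := by
      simpa using ((tendsto_pow_atTop_nhds_zero_of_lt_one hq0 hq1).pow 2).mul_const (h u - m)
    linarith [le_of_tendsto_of_tendsto' h1 h2 hiter]
  refine ⟨v, fun w => hvm.trans (hm w), ?_, ?_⟩
  · have := norm_sq_gradient_le hMp hdesc hbdd v
    have h0 : h v - ⨅ v, h v = 0 := by linarith [hm v]
    rw [h0, mul_zero] at this
    exact norm_eq_zero.1 (pow_eq_zero_iff two_ne_zero |>.1 (le_antisymm this (by positivity)))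
  · have := dist_le_of_le_geometric_of_tendsto₀ q _ hq1 hdist hv
    rw [Function.iterate_zero, id, dist_eq_norm] at this
    have e : √(h u - m) / (1 - q) = 8 * M ^ 2 * √(h u - m) := by
      rw [hq]; field_simp; ring
    rw [e] at this
    calc ‖u - v‖ ^ 2 ≤ (8 * M ^ 2 * √(h u - m)) ^ 2 := by gcongr
      _ = _ := by rw [mul_pow, Real.sq_sqrt hΔ]; ring

end Analysis

/-! ### Partial gradients and Hessian blocks as components of the joint derivatives. -/

section Blocks

variable {dx dy : ℕ}

/-- The point `(x, y)` of the Euclidean product. -/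
abbrev pt (x : E dx) (y : E dy) : WithLp 2 (E dx × E dy) := WithLp.toLp 2 (x, y)

theorem pt_sub_left (x x' : E dx) (y : E dy) : pt x y - pt x' y = pt (x - x') 0 := by
  rw [← WithLp.toLp_sub, Prod.mk_sub_mk, sub_self]

theorem pt_sub_right (x : E dx) (y y' : E dy) : pt x y - pt x y' = pt 0 (y - y') := by
  rw [← WithLp.toLp_sub, Prod.mk_sub_mk, sub_self]

theorem norm_pt_left (x : E dx) : ‖(pt x 0 : WithLp 2 (E dx × E dy))‖ = ‖x‖ :=
  WithLp.norm_toLp_fst 2 _ _ x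

theorem norm_pt_right (y : E dy) : ‖(pt 0 y : WithLp 2 (E dx × E dy))‖ = ‖y‖ :=
  WithLp.norm_toLp_snd 2 _ _ y

/-- The embedding `y ↦ (0, y)`. -/
def inrL : E dy →L[ℝ] WithLp 2 (E dx × E dy) :=
  ((WithLp.prodContinuousLinearEquiv 2 ℝ (E dx) (E dy)).symm :
    E dx × E dy →L[ℝ] WithLp 2 (E dx × E dy)).comp (ContinuousLinearMap.inr ℝ (E dx) (E dy))

/-- The embedding `x ↦ (x, 0)`. -/
def inlL : E dx →L[ℝ] WithLp 2 (E dx × E dy) :=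
  ((WithLp.prodContinuousLinearEquiv 2 ℝ (E dx) (E dy)).symm :
    E dx × E dy →L[ℝ] WithLp 2 (E dx × E dy)).comp (ContinuousLinearMap.inl ℝ (E dx) (E dy))

theorem hasFDerivAt_pt_right (x : E dx) (y : E dy) :
    HasFDerivAt (fun y' => pt x y') inrL y :=
  ((WithLp.prodContinuousLinearEquiv 2 ℝ (E dx) (E dy)).symm :
    E dx × E dy →L[ℝ] WithLp 2 (E dx × E dy)).hasFDerivAt.comp y (hasFDerivAt_prodMk_right x y)

theorem hasFDerivAt_pt_left (x : E dx) (y : E dy) :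
    HasFDerivAt (fun x' => pt x' y) inlL x :=
  ((WithLp.prodContinuousLinearEquiv 2 ℝ (E dx) (E dy)).symm :
    E dx × E dy →L[ℝ] WithLp 2 (E dx × E dy)).hasFDerivAt.comp x (hasFDerivAt_prodMk_left x y)

theorem inner_pt_left (z : WithLp 2 (E dx × E dy)) (u : E dx) :
    inner ℝ z (pt u 0) = inner ℝ z.fst u := by
  simp [WithLp.prod_inner_apply]

theorem inner_pt_right (z : WithLp 2 (E dx × E dy)) (u : E dy) :
    inner ℝ z (pt 0 u) = inner ℝ z.snd u := by
  simp [WithLp.prod_inner_apply]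

variable {h : E dx → E dy → ℝ}

theorem gradX_eq (hd : Differentiable ℝ (joint h)) (x : E dx) (y : E dy) :
    gradX h x y = (∇ (joint h) (pt x y)).fst := by
  apply HasGradientAt.gradient
  rw [hasGradientAt_iff_hasFDerivAt]
  refine ((hd (pt x y)).hasFDerivAt.comp x (hasFDerivAt_pt_left x y)).congr_fderiv ?_
  ext u
  rw [← toDual_gradient]
  exact inner_pt_left _ u

theorem gradY_eq (hd : Differentiable ℝ (joint h)) (x : E dx) (y : E dy) :
    gradY h x y = (∇ (joint h) (pt x y)).snd := by
  apply HasGradientAt.gradient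
  rw [hasGradientAt_iff_hasFDerivAt]
  refine ((hd (pt x y)).hasFDerivAt.comp y (hasFDerivAt_pt_right x y)).congr_fderiv ?_
  ext u
  rw [← toDual_gradient]
  exact inner_pt_right _ u

theorem hessYY_apply (hd : Differentiable ℝ (joint h)) (hG : Differentiable ℝ (∇ (joint h)))
    (x : E dx) (y v : E dy) :
    hessYY h x y v = (fderiv ℝ (∇ (joint h)) (pt x y) (pt 0 v)).snd := by
  have : HasFDerivAt (fun y' => gradY h x y')
      ((WithLp.sndL 2 ℝ (E dx) (E dy)).comp ((fderiv ℝ (∇ (joint h)) (pt x y)).comp inrL)) y := by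
    simp_rw [gradY_eq hd]
    exact (WithLp.sndL 2 ℝ (E dx) (E dy)).hasFDerivAt.comp y
      ((hG (pt x y)).hasFDerivAt.comp y (hasFDerivAt_pt_right x y))
  rw [hessYY, this.fderiv]
  rfl

theorem hessXY_apply (hd : Differentiable ℝ (joint h)) (hG : Differentiable ℝ (∇ (joint h)))
    (x : E dx) (y v : E dy) :
    hessXY h x y v = (fderiv ℝ (∇ (joint h)) (pt x y) (pt 0 v)).fst := by
  have : HasFDerivAt (fun y' => gradX h x y')
      ((WithLp.fstL 2 ℝ (E dx) (E dy)).comp ((fderiv ℝ (∇ (joint h)) (pt x y)).comp inrL)) y := by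
    simp_rw [gradX_eq hd]
    exact (WithLp.fstL 2 ℝ (E dx) (E dy)).hasFDerivAt.comp y
      ((hG (pt x y)).hasFDerivAt.comp y (hasFDerivAt_pt_right x y))
  rw [hessXY, this.fderiv]
  rfl

theorem continuous_of_joint (hd : Differentiable ℝ (joint h)) (x : E dx) : Continuous (h x) :=
  continuous_iff_continuousAt.2 fun y =>
    ((hd (pt x y)).hasFDerivAt.comp y (hasFDerivAt_pt_right x y)).continuousAt

theorem norm_fst_le' (z : WithLp 2 (E dx × E dy)) : ‖z.fst‖ ≤ ‖z‖ := WithLp.norm_fst_le _ z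

theorem norm_snd_le' (z : WithLp 2 (E dx × E dy)) : ‖z.snd‖ ≤ ‖z‖ := WithLp.norm_snd_le _ z

theorem hessYY_isSymmetric (hd : Differentiable ℝ (joint h))
    (hG : Differentiable ℝ (∇ (joint h))) (x : E dx) (y : E dy) :
    (hessYY h x y : E dy →ₗ[ℝ] E dy).IsSymmetric := by
  intro u v
  change inner ℝ (hessYY h x y u) v = inner ℝ u (hessYY h x y v)
  rw [hessYY_apply hd hG, hessYY_apply hd hG, ← inner_pt_right, inner_fderiv_gradient_comm hd hG,
    inner_pt_right, real_inner_comm]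

theorem abs_joint_sub_sub_inner_le {L : ℝ≥0} (hd : Differentiable ℝ (joint h))
    (hL : LipschitzWith L (∇ (joint h))) (z z' : WithLp 2 (E dx × E dy)) :
    |joint h z' - joint h z - inner ℝ (∇ (joint h) z) (z' - z)| ≤ L * ‖z' - z‖ ^ 2 := by
  rw [inner_gradient_left]
  exact norm_sub_sub_fderiv_le hd (lipschitzWith_fderiv_of_gradient hL) z z'

theorem abs_sub_sub_inner_gradX_le {L : ℝ≥0} (hd : Differentiable ℝ (joint h))
    (hL : LipschitzWith L (∇ (joint h))) (x x' : E dx) (y : E dy) :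
    |h x' y - h x y - inner ℝ (gradX h x y) (x' - x)| ≤ L * ‖x' - x‖ ^ 2 := by
  have := abs_joint_sub_sub_inner_le hd hL (pt x y) (pt x' y)
  rwa [pt_sub_left, norm_pt_left, inner_pt_left, ← gradX_eq hd] at this

theorem abs_sub_sub_inner_gradY_le {L : ℝ≥0} (hd : Differentiable ℝ (joint h))
    (hL : LipschitzWith L (∇ (joint h))) (x : E dx) (y y' : E dy) :
    |h x y' - h x y - inner ℝ (gradY h x y) (y' - y)| ≤ L * ‖y' - y‖ ^ 2 := by
  have := abs_joint_sub_sub_inner_le hd hL (pt x y) (pt x y')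
  rwa [pt_sub_right, norm_pt_right, inner_pt_right, ← gradY_eq hd] at this

section Lipschitz

variable {L : ℝ≥0} (hd : Differentiable ℝ (joint h)) (hL : LipschitzWith L (∇ (joint h)))
include hd hL

theorem norm_gradX_sub_left_le (x x' : E dx) (y : E dy) :
    ‖gradX h x y - gradX h x' y‖ ≤ L * ‖x - x'‖ := by
  rw [gradX_eq hd, gradX_eq hd, ← WithLp.sub_fst]
  refine (norm_fst_le' _).trans ((hL.norm_sub_le _ _).trans_eq ?_)
  rw [pt_sub_left, norm_pt_left]

theorem norm_gradX_sub_right_le (x : E dx) (y y' : E dy) :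
    ‖gradX h x y - gradX h x y'‖ ≤ L * ‖y - y'‖ := by
  rw [gradX_eq hd, gradX_eq hd, ← WithLp.sub_fst]
  refine (norm_fst_le' _).trans ((hL.norm_sub_le _ _).trans_eq ?_)
  rw [pt_sub_right, norm_pt_right]

theorem norm_gradY_sub_left_le (x x' : E dx) (y : E dy) :
    ‖gradY h x y - gradY h x' y‖ ≤ L * ‖x - x'‖ := by
  rw [gradY_eq hd, gradY_eq hd, ← WithLp.sub_snd]
  refine (norm_snd_le' _).trans ((hL.norm_sub_le _ _).trans_eq ?_)
  rw [pt_sub_left, norm_pt_left]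

theorem norm_gradY_sub_right_le (x : E dx) (y y' : E dy) :
    ‖gradY h x y - gradY h x y'‖ ≤ L * ‖y - y'‖ := by
  rw [gradY_eq hd, gradY_eq hd, ← WithLp.sub_snd]
  refine (norm_snd_le' _).trans ((hL.norm_sub_le _ _).trans_eq ?_)
  rw [pt_sub_right, norm_pt_right]

theorem norm_hessYY_le (hG : Differentiable ℝ (∇ (joint h))) (x : E dx) (y : E dy) :
    ‖hessYY h x y‖ ≤ L := by
  refine ContinuousLinearMap.opNorm_le_bound _ L.2 fun v => ?_
  rw [hessYY_apply hd hG, ← norm_pt_right (dx := dx) v]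
  exact (norm_snd_le' _).trans (ContinuousLinearMap.le_of_opNorm_le _
    (norm_fderiv_le_of_lipschitz ℝ hL) _)

theorem norm_hessXY_le (hG : Differentiable ℝ (∇ (joint h))) (x : E dx) (y : E dy) :
    ‖hessXY h x y‖ ≤ L := by
  refine ContinuousLinearMap.opNorm_le_bound _ L.2 fun v => ?_
  rw [hessXY_apply hd hG, ← norm_pt_right (dx := dx) v]
  exact (norm_fst_le' _).trans (ContinuousLinearMap.le_of_opNorm_le _
    (norm_fderiv_le_of_lipschitz ℝ hL) _)

end Lipschitz

section SecondOrder

variable {L : ℝ≥0} (hd : Differentiable ℝ (joint h)) (hG : Differentiable ℝ (∇ (joint h)))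
  (hL : LipschitzWith L (fderiv ℝ (∇ (joint h))))
include hd hG hL

theorem norm_hessYY_sub_left_le (x x' : E dx) (y : E dy) :
    ‖hessYY h x y - hessYY h x' y‖ ≤ L * ‖x - x'‖ := by
  refine ContinuousLinearMap.opNorm_le_bound _ (by positivity) fun v => ?_
  rw [_root_.sub_apply, hessYY_apply hd hG, hessYY_apply hd hG, ← WithLp.sub_snd,
    ← _root_.sub_apply, ← norm_pt_right (dx := dx) v]
  refine (norm_snd_le' _).trans (ContinuousLinearMap.le_of_opNorm_le _ ?_ _)
  refine (hL.norm_sub_le _ _).trans_eq ?_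
  rw [pt_sub_left, norm_pt_left]

theorem norm_hessYY_sub_right_le (x : E dx) (y y' : E dy) :
    ‖hessYY h x y - hessYY h x y'‖ ≤ L * ‖y - y'‖ := by
  refine ContinuousLinearMap.opNorm_le_bound _ (by positivity) fun v => ?_
  rw [_root_.sub_apply, hessYY_apply hd hG, hessYY_apply hd hG, ← WithLp.sub_snd,
    ← _root_.sub_apply, ← norm_pt_right (dx := dx) v]
  refine (norm_snd_le' _).trans (ContinuousLinearMap.le_of_opNorm_le _ ?_ _)
  refine (hL.norm_sub_le _ _).trans_eq ?_
  rw [pt_sub_right, norm_pt_right]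

theorem norm_hessXY_sub_left_le (x x' : E dx) (y : E dy) :
    ‖hessXY h x y - hessXY h x' y‖ ≤ L * ‖x - x'‖ := by
  refine ContinuousLinearMap.opNorm_le_bound _ (by positivity) fun v => ?_
  rw [_root_.sub_apply, hessXY_apply hd hG, hessXY_apply hd hG, ← WithLp.sub_fst,
    ← _root_.sub_apply, ← norm_pt_right (dx := dx) v]
  refine (norm_fst_le' _).trans (ContinuousLinearMap.le_of_opNorm_le _ ?_ _)
  refine (hL.norm_sub_le _ _).trans_eq ?_
  rw [pt_sub_left, norm_pt_left]

theorem norm_gradY_sub_sub_hessYY_le (x : E dx) (y y' : E dy) :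
    ‖gradY h x y' - gradY h x y - hessYY h x y (y' - y)‖ ≤ L * ‖y' - y‖ ^ 2 := by
  have := norm_sub_sub_fderiv_le hG hL (pt x y) (pt x y')
  rw [pt_sub_right, norm_pt_right] at this
  rw [gradY_eq hd, gradY_eq hd, hessYY_apply hd hG, ← WithLp.sub_snd, ← WithLp.sub_snd]
  exact (norm_snd_le' _).trans this

/-- Symmetry of the second derivative identifies ∇²_xy g w, a y-derivative of ∇_x g, with the
x-gradient of ⟨w, ∇_y g⟩. This makes the direction of the algorithm a gradient of the corrected
objective. -/
theorem abs_inner_gradY_sub_sub_hessXY_le (x x' : E dx) (y w : E dy) :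
    |inner ℝ w (gradY h x' y - gradY h x y) - inner ℝ (hessXY h x y w) (x' - x)|
      ≤ L * ‖w‖ * ‖x' - x‖ ^ 2 := by
  have h1 := norm_sub_sub_fderiv_le hG hL (pt x y) (pt x' y)
  rw [pt_sub_left, norm_pt_left] at h1
  rw [gradY_eq hd, gradY_eq hd, hessXY_apply hd hG, ← inner_pt_left,
    ← inner_fderiv_gradient_comm hd hG, inner_pt_right, ← WithLp.sub_snd,
    real_inner_comm, ← inner_sub_left, ← WithLp.sub_snd]
  refine (abs_real_inner_le_norm _ _).trans ?_
  calc _ ≤ (L * ‖x' - x‖ ^ 2) * ‖w‖ := by gcongr; exact (norm_snd_le' _).trans h1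
    _ = _ := by ring

end SecondOrder

theorem norm_gradY_le {L : ℝ≥0} {x : E dx} (hL : LipschitzWith L (h x)) (y : E dy) :
    ‖gradY h x y‖ ≤ L := by
  rw [gradY, gradient, LinearIsometryEquiv.norm_map]
  exact norm_fderiv_le_of_lipschitz ℝ hL

end Blocks

/-! ### All assumptions condensed into a single constant. -/

section Regularity

variable {dx dy : ℕ}

/-- Quantitative consequences of the assumptions, with one constant `M` for all of them; `P` is
the pseudoinverse of `∇²_yy g`. -/
structure Regularity (M : ℝ) (f g : E dx → E dy → ℝ) (P : E dx → E dy → E dy →L[ℝ] E dy) :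
    Prop where
  one_le : 1 ≤ M
  f_lip : ∀ x y y', f x y - f x y' ≤ M * ‖y - y'‖
  f_descent_x : ∀ x x' y, f x' y ≤ f x y + inner ℝ (gradX f x y) (x' - x) + M * ‖x' - x‖ ^ 2
  f_descent_y : ∀ x y y', f x y' ≤ f x y + inner ℝ (gradY f x y) (y' - y) + M * ‖y' - y‖ ^ 2
  gradX_f_lip : ∀ x x' y, ‖gradX f x y - gradX f x' y‖ ≤ M * ‖x - x'‖
  gradY_f_lip_x : ∀ x x' y, ‖gradY f x y - gradY f x' y‖ ≤ M * ‖x - x'‖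
  gradY_f_lip_y : ∀ x y y', ‖gradY f x y - gradY f x y'‖ ≤ M * ‖y - y'‖
  gradY_f_le : ∀ x y, ‖gradY f x y‖ ≤ M
  g_taylor_x : ∀ x x' y, |g x' y - g x y - inner ℝ (gradX g x y) (x' - x)| ≤ M * ‖x' - x‖ ^ 2
  g_descent_y : ∀ x y y', g x y' ≤ g x y + inner ℝ (gradY g x y) (y' - y) + M * ‖y' - y‖ ^ 2
  gradX_g_lip : ∀ x y y', ‖gradX g x y - gradX g x y'‖ ≤ M * ‖y - y'‖
  gradY_g_lip_x : ∀ x x' y, ‖gradY g x y - gradY g x' y‖ ≤ M * ‖x - x'‖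
  gradY_g_lip_y : ∀ x y y', ‖gradY g x y - gradY g x y'‖ ≤ M * ‖y - y'‖
  gradY_g_taylor_x : ∀ x x' y w,
    |inner ℝ w (gradY g x' y - gradY g x y) - inner ℝ (hessXY g x y w) (x' - x)|
      ≤ M * ‖w‖ * ‖x' - x‖ ^ 2
  gradY_g_taylor_y : ∀ x y y',
    ‖gradY g x y' - gradY g x y - hessYY g x y (y' - y)‖ ≤ M * ‖y' - y‖ ^ 2
  hessYY_symm : ∀ x y, (hessYY g x y : E dy →ₗ[ℝ] E dy).IsSymmetric
  hessYY_le : ∀ x y, ‖hessYY g x y‖ ≤ M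
  hessYY_lip_x : ∀ x x' y, ‖hessYY g x y - hessYY g x' y‖ ≤ M * ‖x - x'‖
  hessYY_lip_y : ∀ x y y', ‖hessYY g x y - hessYY g x y'‖ ≤ M * ‖y - y'‖
  hessXY_le : ∀ x y, ‖hessXY g x y‖ ≤ M
  hessXY_lip : ∀ x x' y, ‖hessXY g x y - hessXY g x' y‖ ≤ M * ‖x - x'‖
  pinv : ∀ x y, IsPseudoinverse (hessYY g x y) (P x y)
  pinv_le : ∀ x y, ‖P x y‖ ≤ M
  bddBelow : ∀ x, BddBelow (Set.range (g x))
  pl : ∀ x y, resY g x y ≤ M * ‖gradY g x y‖ ^ 2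
  error_bound : ∀ x y, ∃ v ∈ solSet g x, gradY g x v = 0 ∧ ‖y - v‖ ^ 2 ≤ M * resY g x y

theorem exists_regularity (lf0 lf1 lg1 lg2 : ℝ≥0) (mu lam : ℝ) (hmu : 0 < mu) (hlam : 0 < lam) :
    ∃ M : ℝ, 1 ≤ M ∧ ∀ (dx dy : ℕ) (f g : E dx → E dy → ℝ), LipschitzAssumption lf0 lf1 lg1 lg2 f g →
      PLAssumption mu lam g → ∃ P, Regularity M f g P := by
  set m : ℝ := 1 + lf0 + lf1 + lg1 + lg2 + lam⁻¹ + mu⁻¹ with hm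
  have p1 : 0 < lam⁻¹ := by positivity
  have p2 : 0 < mu⁻¹ := by positivity
  have q1 : (0 : ℝ) ≤ lf0 := lf0.2
  have q2 : (0 : ℝ) ≤ lf1 := lf1.2
  have q3 : (0 : ℝ) ≤ lg1 := lg1.2
  have q4 : (0 : ℝ) ≤ lg2 := lg2.2
  have m1 : 1 ≤ m := by rw [hm]; linarith
  have hmM : m ≤ 64 * m ^ 4 := by
    nlinarith [one_le_pow₀ (n := 3) m1]
  have bf0 : (lf0 : ℝ) ≤ 64 * m ^ 4 := le_trans (by rw [hm]; linarith) hmM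
  have bf1 : (lf1 : ℝ) ≤ 64 * m ^ 4 := le_trans (by rw [hm]; linarith) hmM
  have bg1' : (lg1 : ℝ) ≤ m := by rw [hm]; linarith
  have bg1 : (lg1 : ℝ) ≤ 64 * m ^ 4 := bg1'.trans hmM
  have bg2 : (lg2 : ℝ) ≤ 64 * m ^ 4 := le_trans (by rw [hm]; linarith) hmM
  have bl : lam⁻¹ ≤ 64 * m ^ 4 := le_trans (by rw [hm]; linarith) hmM
  -- The error bound produces 64m⁴ from `m`; every other estimate only needs a constant that is at
  -- least its own.
  refine ⟨64 * m ^ 4, m1.trans hmM, fun dx dy f g hL hP => ?_⟩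
  have hsymm := hessYY_isSymmetric hL.diff_g hL.diff_grad_g
  choose P hP1 hP2 using fun x y =>
    exists_isPseudoinverse (hessYY g x y) (hsymm x y) hlam (hP.singular x y)
  have hpl : ∀ x y, resY g x y ≤ m * ‖gradY g x y‖ ^ 2 := by
    intro x y
    have h1 := hP.pl x y
    have h2 : mu⁻¹ ≤ m := by rw [hm]; linarith
    have h3 : 0 ≤ resY g x y := sub_nonneg.2 (ciInf_le (hP.bddBelow x) y)
    have h4 : mu⁻¹ * (2 * mu * resY g x y) = 2 * resY g x y := by field_simp
    calc resY g x y ≤ mu⁻¹ * (2 * mu * resY g x y) := by linarith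
      _ ≤ mu⁻¹ * ‖gradY g x y‖ ^ 2 := by gcongr; exact h1
      _ ≤ _ := by gcongr
  have hfx := abs_sub_sub_inner_gradX_le hL.diff_f hL.lip_grad_f
  have hfy := abs_sub_sub_inner_gradY_le hL.diff_f hL.lip_grad_f
  have hgy := abs_sub_sub_inner_gradY_le hL.diff_g hL.lip_grad_g
  refine ⟨P, ?_⟩
  constructor
  case one_le => exact m1.trans hmM
  case f_lip =>
    intro x y y'
    refine (le_abs_self _).trans (((hL.lip_f x).norm_sub_le y y').trans ?_)
    gcongr
  case f_descent_x =>
    intro x x' y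
    have := (abs_le.1 ((hfx x x' y).trans (mul_le_mul_of_nonneg_right bf1 (sq_nonneg _)))).2
    linarith
  case f_descent_y =>
    intro x y y'
    have := (abs_le.1 ((hfy x y y').trans (mul_le_mul_of_nonneg_right bf1 (sq_nonneg _)))).2
    linarith
  case gradX_f_lip =>
    exact fun x x' y => (norm_gradX_sub_left_le hL.diff_f hL.lip_grad_f x x' y).trans (by gcongr)
  case gradY_f_lip_x =>
    exact fun x x' y => (norm_gradY_sub_left_le hL.diff_f hL.lip_grad_f x x' y).trans (by gcongr)
  case gradY_f_lip_y =>
    exact fun x y y' => (norm_gradY_sub_right_le hL.diff_f hL.lip_grad_f x y y').trans (by gcongr)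
  case gradY_f_le => exact fun x y => (norm_gradY_le (hL.lip_f x) y).trans bf0
  case g_taylor_x =>
    exact fun x x' y => (abs_sub_sub_inner_gradX_le hL.diff_g hL.lip_grad_g x x' y).trans
      (by gcongr)
  case g_descent_y =>
    intro x y y'
    have := (abs_le.1 ((hgy x y y').trans (mul_le_mul_of_nonneg_right bg1 (sq_nonneg _)))).2
    linarith
  case gradX_g_lip =>
    exact fun x y y' => (norm_gradX_sub_right_le hL.diff_g hL.lip_grad_g x y y').trans (by gcongr)
  case gradY_g_lip_x =>
    exact fun x x' y => (norm_gradY_sub_left_le hL.diff_g hL.lip_grad_g x x' y).trans (by gcongr)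
  case gradY_g_lip_y =>
    exact fun x y y' => (norm_gradY_sub_right_le hL.diff_g hL.lip_grad_g x y y').trans (by gcongr)
  case gradY_g_taylor_x =>
    exact fun x x' y w => (abs_inner_gradY_sub_sub_hessXY_le hL.diff_g hL.diff_grad_g
      hL.lip_hess_g x x' y w).trans (by gcongr)
  case gradY_g_taylor_y =>
    exact fun x y y' => (norm_gradY_sub_sub_hessYY_le hL.diff_g hL.diff_grad_g
      hL.lip_hess_g x y y').trans (by gcongr)
  case hessYY_symm => exact hsymm
  case hessYY_le =>
    exact fun x y => (norm_hessYY_le hL.diff_g hL.lip_grad_g hL.diff_grad_g x y).trans bg1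
  case hessYY_lip_x =>
    exact fun x x' y => (norm_hessYY_sub_left_le hL.diff_g hL.diff_grad_g
      hL.lip_hess_g x x' y).trans (by gcongr)
  case hessYY_lip_y =>
    exact fun x y y' => (norm_hessYY_sub_right_le hL.diff_g hL.diff_grad_g
      hL.lip_hess_g x y y').trans (by gcongr)
  case hessXY_le =>
    exact fun x y => (norm_hessXY_le hL.diff_g hL.lip_grad_g hL.diff_grad_g x y).trans bg1
  case hessXY_lip =>
    exact fun x x' y => (norm_hessXY_sub_left_le hL.diff_g hL.diff_grad_g
      hL.lip_hess_g x x' y).trans (by gcongr)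
  case pinv => exact hP1
  case pinv_le => exact fun x y => (hP2 x y).trans bl
  case bddBelow => exact hP.bddBelow
  case pl => exact fun x y => (hpl x y).trans (by gcongr)
  case error_bound =>
    intro x y
    refine exists_isMin_of_polyakLojasiewicz (h := g x) (G := gradY g x) m1 ?_ ?_
      (hP.bddBelow x) (hpl x) y
    · exact continuous_of_joint hL.diff_g x
    · intro y y'
      have := (abs_le.1 ((hgy x y y').trans (mul_le_mul_of_nonneg_right bg1' (sq_nonneg _)))).2
      linarith

end Regularity

/-! ### Descent of the Lyapunov function. -/

section Descent

variable {dx dy : ℕ} {M : ℝ} {f g : E dx → E dy → ℝ} {P : E dx → E dy → E dy →L[ℝ] E dy}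

/-- The minimal-norm solution `w† = -(∇²_yy g)† ∇_y f` of the linear system in `w`. -/
def wDagger (f : E dx → E dy → ℝ) (P : E dx → E dy → E dy →L[ℝ] E dy) (x : E dx) (y : E dy) :
    E dy :=
  -P x y (gradY f x y)

/-- The objective corrected by the lower-level gradient along `w†`. -/
def correctedObjective (f g : E dx → E dy → ℝ) (P : E dx → E dy → E dy →L[ℝ] E dy) (x : E dx)
    (y : E dy) : ℝ :=
  f x y + inner ℝ (wDagger f P x y) (gradY g x y)

/-- The Lyapunov function of the outer iteration. -/
def lyapunov (M : ℝ) (f g : E dx → E dy → ℝ) (P : E dx → E dy → E dy →L[ℝ] E dy) (x : E dx)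
    (y : E dy) : ℝ :=
  correctedObjective f g P x y + 64 * M ^ 7 * resY g x y

namespace Regularity

variable (hR : Regularity M f g P)
include hR

theorem pos : 0 < M := zero_lt_one.trans_le hR.one_le

theorem pow_le {m n : ℕ} (h : m ≤ n) : M ^ m ≤ M ^ n := pow_le_pow_right₀ hR.one_le h

theorem resY_nonneg (x : E dx) (y : E dy) : 0 ≤ resY g x y :=
  sub_nonneg.2 (ciInf_le (hR.bddBelow x) y)

theorem norm_sq_gradY_le (x : E dx) (y : E dy) : ‖gradY g x y‖ ^ 2 ≤ 4 * M * resY g x y :=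
  norm_sq_gradient_le hR.pos (hR.g_descent_y x) (hR.bddBelow x) y

theorem norm_wDagger_le (x : E dx) (y : E dy) : ‖wDagger f P x y‖ ≤ M ^ 2 := by
  have := hR.pos
  rw [wDagger, norm_neg, pow_two]
  exact ((P x y).le_opNorm _).trans
    (mul_le_mul (hR.pinv_le x y) (hR.gradY_f_le x y) (norm_nonneg _) this.le)

theorem norm_wDagger_sub_le {x x' : E dx} {y y' : E dy} {r : ℝ}
    (hH : ‖hessYY g x y - hessYY g x' y'‖ ≤ M * r) (hf : ‖gradY f x y - gradY f x' y'‖ ≤ M * r)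
    (hr : 0 ≤ r) :
    ‖wDagger f P x y - wDagger f P x' y'‖ ≤ 6 * M ^ 6 * r := by
  have := hR.pos
  have e : wDagger f P x y - wDagger f P x' y'
      = -((P x y - P x' y') (gradY f x y) + P x' y' (gradY f x y - gradY f x' y')) := by
    simp only [wDagger, _root_.sub_apply, map_sub]; abel
  have hP := (hR.pinv x y).norm_sub_le (hR.pinv x' y') hR.one_le (hR.hessYY_le x y)
    (hR.hessYY_le x' y') (hR.pinv_le x y) (hR.pinv_le x' y')
  have hM2 := mul_le_mul_of_nonneg_right (hR.pow_le (show 2 ≤ 6 by norm_num)) hr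
  rw [e, norm_neg]
  calc _ ≤ ‖P x y - P x' y'‖ * ‖gradY f x y‖ + ‖P x' y'‖ * ‖gradY f x y - gradY f x' y'‖ :=
        norm_add_le_of_le (ContinuousLinearMap.le_opNorm _ _) (ContinuousLinearMap.le_opNorm _ _)
    _ ≤ (5 * M ^ 4 * (M * r)) * M + M * (M * r) := by
        gcongr
        · exact hP.trans (by gcongr)
        · exact hR.gradY_f_le x y
        · exact hR.pinv_le x' y'
    _ = 5 * (M ^ 6 * r) + M ^ 2 * r := by ring
    _ ≤ 6 * M ^ 6 * r := by linarith

theorem norm_wDagger_sub_left_le (x x' : E dx) (y : E dy) :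
    ‖wDagger f P x y - wDagger f P x' y‖ ≤ 6 * M ^ 6 * ‖x - x'‖ :=
  hR.norm_wDagger_sub_le (hR.hessYY_lip_x x x' y) (hR.gradY_f_lip_x x x' y) (norm_nonneg _)

theorem norm_wDagger_sub_right_le (x : E dx) (y y' : E dy) :
    ‖wDagger f P x y - wDagger f P x y'‖ ≤ 6 * M ^ 6 * ‖y - y'‖ :=
  hR.norm_wDagger_sub_le (hR.hessYY_lip_y x y y') (hR.gradY_f_lip_y x y y') (norm_nonneg _)

/-- The normal equation for w†. Equivalently, ∇_y f + Hw† lies in ker H. -/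
theorem hessYY_gradY_eq (x : E dx) (y : E dy) :
    hessYY g x y (gradY f x y) = -hessYY g x y (hessYY g x y (wDagger f P x y)) := by
  have h1 : hessYY g x y (P x y (hessYY g x y (gradY f x y))) = hessYY g x y (gradY f x y) :=
    congrArg (· (gradY f x y)) (hR.pinv x y).mul_inv_mul
  have h2 : hessYY g x y (P x y (gradY f x y)) = P x y (hessYY g x y (gradY f x y)) :=
    congrArg (· (gradY f x y)) (hR.pinv x y).comm
  rw [wDagger, map_neg, map_neg, neg_neg, h2, h1]

/-- The gradient of `g(x, ·)` is almost in the range of its Hessian. -/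
theorem abs_inner_gradY_add_le (x : E dx) (y : E dy) :
    |inner ℝ (gradY f x y + hessYY g x y (wDagger f P x y)) (gradY g x y)|
      ≤ 2 * M ^ 6 * ‖gradY g x y‖ ^ 2 := by
  have hM := hR.pos
  obtain ⟨v, -, hv, hyv⟩ := hR.error_bound x y
  set q := gradY f x y + hessYY g x y (wDagger f P x y) with hq
  have hq0 : hessYY g x y q = 0 := by
    rw [hq, map_add, hR.hessYY_gradY_eq, neg_add_cancel]
  set r := gradY g x v - gradY g x y - hessYY g x y (v - y) with hr
  -- Expand at the minimizer `v`, where the gradient vanishes. The linear part lies in the range of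
  -- the symmetric Hessian, hence is orthogonal to `q` in its kernel; only the quadratic remainder
  -- survives.
  have hg : gradY g x y = hessYY g x y (y - v) - r := by
    rw [hr, hv, ← neg_sub v y, map_neg]; abel
  have hin : inner ℝ q (gradY g x y) = -inner ℝ q r := by
    have h0 : inner ℝ q (hessYY g x y (y - v)) = 0 := by
      have : inner ℝ (hessYY g x y q) (y - v) = inner ℝ q (hessYY g x y (y - v)) :=
        hR.hessYY_symm x y q (y - v)
      rw [← this, hq0, inner_zero_left]
    rw [hg, inner_sub_right, h0, zero_sub]
  have hrn : ‖r‖ ≤ M ^ 3 * ‖gradY g x y‖ ^ 2 := by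
    calc ‖r‖ ≤ M * ‖y - v‖ ^ 2 := by rw [norm_sub_rev y v]; exact hR.gradY_g_taylor_y x y v
      _ ≤ M * (M * (M * ‖gradY g x y‖ ^ 2)) := by
          gcongr; exact hyv.trans (by gcongr; exact hR.pl x y)
      _ = _ := by ring
  have hqn : ‖q‖ ≤ 2 * M ^ 3 := by
    have h1 := hR.pow_le (show 1 ≤ 3 by norm_num)
    calc ‖q‖ ≤ M + M * M ^ 2 := norm_add_le_of_le (hR.gradY_f_le x y)
          (ContinuousLinearMap.le_of_opNorm_le_of_le _ (hR.hessYY_le x y) (hR.norm_wDagger_le x y))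
      _ ≤ 2 * M ^ 3 := by rw [pow_one] at h1; linarith [show M * M ^ 2 = M ^ 3 by ring]
  rw [hin, abs_neg]
  calc _ ≤ ‖q‖ * ‖r‖ := abs_real_inner_le_norm _ _
    _ ≤ (2 * M ^ 3) * (M ^ 3 * ‖gradY g x y‖ ^ 2) := by gcongr
    _ = _ := by ring

/-- The first-order change is -β⟨∇_y f + Hw†, ∇_y g⟩, which near-orthogonality makes quadratic in
∇_y g. The 16 adds up 1 (Taylor for f), 12 (variation of w†), 1 (Taylor for ∇_y g) and 2
(near-orthogonality). -/
theorem correctedObjective_y_step_le {β : ℝ} (hβ : 0 < β) (hβM : 2 * M * β ≤ 1) (x : E dx)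
    (y : E dy) :
    correctedObjective f g P x (y - β • gradY g x y)
      ≤ correctedObjective f g P x y + 16 * M ^ 7 * β * ‖gradY g x y‖ ^ 2 := by
  have hM := hR.pos
  have hM1 := hR.one_le
  have hβ1 : β ≤ 1 := by nlinarith
  have hMβ : M * β ≤ 1 := by nlinarith
  set G := gradY g x y with hG
  set y' := y - β • G with hy'
  have hd : y' - y = -(β • G) := by rw [hy']; abel
  have hdn : ‖y' - y‖ = β * ‖G‖ := by rw [hd, norm_neg, norm_smul, Real.norm_of_nonneg hβ.le]
  have hββ : β ^ 2 * ‖G‖ ^ 2 ≤ β * ‖G‖ ^ 2 := by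
    rw [pow_two β, mul_assoc]; exact mul_le_of_le_one_left (by positivity) hβ1
  have h1 := hR.f_descent_y x y y'
  rw [hdn, hd, inner_neg_right, inner_smul_right, mul_pow] at h1
  have hG' : ‖gradY g x y'‖ ≤ 2 * ‖G‖ := by
    have := hR.gradY_g_lip_y x y' y
    rw [hdn] at this
    have h2 : ‖gradY g x y'‖ ≤ ‖G‖ + ‖gradY g x y' - gradY g x y‖ := norm_le_insert' _ _
    have h3 : M * (β * ‖G‖) ≤ 1 * ‖G‖ := by rw [← mul_assoc]; gcongr
    linarith
  have h2 : inner ℝ (wDagger f P x y' - wDagger f P x y) (gradY g x y')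
      ≤ 12 * M ^ 6 * (β * ‖G‖ ^ 2) := by
    have hw := hR.norm_wDagger_sub_right_le x y' y
    rw [hdn] at hw
    calc _ ≤ _ := real_inner_le_norm _ _
      _ ≤ (6 * M ^ 6 * (β * ‖G‖)) * (2 * ‖G‖) := by gcongr
      _ = _ := by ring
  set r := gradY g x y' - gradY g x y - hessYY g x y (y' - y) with hr
  have hrn : ‖r‖ ≤ M * (β ^ 2 * ‖G‖ ^ 2) := by
    rw [← mul_pow, ← hdn]; exact hR.gradY_g_taylor_y x y y'
  have h3 : inner ℝ (wDagger f P x y) r ≤ M ^ 3 * (β * ‖G‖ ^ 2) := by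
    calc _ ≤ _ := real_inner_le_norm _ _
      _ ≤ M ^ 2 * (M * (β * ‖G‖ ^ 2)) := by
          gcongr
          · exact hR.norm_wDagger_le x y
          · exact hrn.trans (by gcongr)
      _ = _ := by ring
  have h4 : inner ℝ (wDagger f P x y) (gradY g x y')
      = inner ℝ (wDagger f P x y) G - β * inner ℝ (hessYY g x y (wDagger f P x y)) G
        + inner ℝ (wDagger f P x y) r := by
    have e : gradY g x y' = G - β • hessYY g x y G + r := by
      rw [hr, hd, map_neg, map_smul, hG]; abel
    have hs : inner ℝ (hessYY g x y (wDagger f P x y)) G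
        = inner ℝ (wDagger f P x y) (hessYY g x y G) := hR.hessYY_symm x y _ _
    rw [e, inner_add_right, inner_sub_right, inner_smul_right, hs]
  have h5 := (abs_le.1 (hR.abs_inner_gradY_add_le x y)).1
  rw [inner_add_left] at h5
  have h5' := mul_le_mul_of_nonneg_left h5 hβ.le
  rw [inner_sub_left] at h2
  have hX : 0 ≤ β * ‖G‖ ^ 2 := by positivity
  have p1 := mul_le_mul_of_nonneg_right (hR.pow_le (show 1 ≤ 7 by norm_num)) hX
  have p3 := mul_le_mul_of_nonneg_right (hR.pow_le (show 3 ≤ 7 by norm_num)) hX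
  have p6 := mul_le_mul_of_nonneg_right (hR.pow_le (show 6 ≤ 7 by norm_num)) hX
  have hf : M * (β ^ 2 * ‖G‖ ^ 2) ≤ M * (β * ‖G‖ ^ 2) := by gcongr
  rw [pow_one] at p1
  simp only [correctedObjective, ← hG]
  rw [← hG] at h5'
  linarith

theorem resY_y_step_le {β : ℝ} (hβ : 0 < β) (hβM : 2 * M * β ≤ 1) (x : E dx) (y : E dy) :
    resY g x (y - β • gradY g x y) ≤ resY g x y - β / 2 * ‖gradY g x y‖ ^ 2 := by
  have := gradient_step_le hβ hβM (hR.g_descent_y x) y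
  simp only [resY]; linarith

/-- The weight 64M⁷ turns the decrease β/2 of g - g* into 32M⁷β, half of which pays for the
corrected objective. -/
theorem lyapunov_y_step_le {β : ℝ} (hβ : 0 < β) (hβM : 2 * M * β ≤ 1) (x : E dx) (y : E dy) :
    lyapunov M f g P x (y - β • gradY g x y)
      ≤ lyapunov M f g P x y - 16 * M ^ 7 * β * ‖gradY g x y‖ ^ 2 := by
  have hM := hR.pos
  have h1 := hR.correctedObjective_y_step_le hβ hβM x y
  have h2 := mul_le_mul_of_nonneg_left (hR.resY_y_step_le hβ hβM x y)
    (show 0 ≤ 64 * M ^ 7 by positivity)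
  simp only [lyapunov]; linarith

theorem innerY_descent {β : ℝ} (hβ : 0 < β) (hβM : 2 * M * β ≤ 1) (x : E dx) (n : ℕ) (y : E dy) :
    lyapunov M f g P x (innerY g β n x y) ≤ lyapunov M f g P x y ∧
      resY g x (innerY g β n x y) ≤ resY g x y := by
  have hM := hR.pos
  induction n generalizing y with
  | zero => exact ⟨le_rfl, le_rfl⟩
  | succ n ih =>
    obtain ⟨h1, h2⟩ := ih (y - β • gradY g x y)
    have h3 := hR.lyapunov_y_step_le hβ hβM x y
    have h4 := hR.resY_y_step_le hβ hβM x y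
    have h5 : 0 ≤ 16 * M ^ 7 * β * ‖gradY g x y‖ ^ 2 := by positivity
    have h6 : 0 ≤ β / 2 * ‖gradY g x y‖ ^ 2 := by positivity
    have e : innerY g β (n + 1) x y = innerY g β n x (y - β • gradY g x y) := rfl
    rw [e]
    exact ⟨by linarith, by linarith⟩

/-- Only the first inner step is exploited, since its gradient sits at the starting point; the later
ones merely do no harm. -/
theorem lyapunov_innerY_le {β : ℝ} (hβ : 0 < β) (hβM : 2 * M * β ≤ 1) {N : ℕ} (hN : 1 ≤ N)
    (x : E dx) (y : E dy) :
    lyapunov M f g P x (innerY g β N x y)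
      ≤ lyapunov M f g P x y - 16 * M ^ 7 * β * ‖gradY g x y‖ ^ 2 := by
  obtain ⟨n, rfl⟩ := Nat.exists_eq_add_of_le' hN
  exact (hR.innerY_descent hβ hβM x n (y - β • gradY g x y)).1.trans
    (hR.lyapunov_y_step_le hβ hβM x y)

theorem correctedObjective_x_step_le (x x' : E dx) (y : E dy) :
    correctedObjective f g P x' y ≤ correctedObjective f g P x y
      + inner ℝ (gradX f x y + hessXY g x y (wDagger f P x y)) (x' - x)
      + 6 * M ^ 6 * (‖gradY g x y‖ * ‖x' - x‖) + 8 * M ^ 7 * ‖x' - x‖ ^ 2 := by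
  have hM := hR.pos
  set δ := ‖x' - x‖ with hδ
  have h1 := hR.f_descent_x x x' y
  have h2 : inner ℝ (wDagger f P x' y - wDagger f P x y) (gradY g x' y)
      ≤ (6 * M ^ 6 * δ) * (‖gradY g x y‖ + M * δ) := by
    refine (real_inner_le_norm _ _).trans ?_
    gcongr
    · exact hR.norm_wDagger_sub_left_le x' x y
    · have : ‖gradY g x' y‖ ≤ ‖gradY g x y‖ + ‖gradY g x' y - gradY g x y‖ := norm_le_insert' _ _
      exact this.trans (by gcongr; exact hR.gradY_g_lip_x x' x y)
  have h3 := (abs_le.1 (hR.gradY_g_taylor_x x x' y (wDagger f P x y))).2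
  have h4 : M * ‖wDagger f P x y‖ * δ ^ 2 ≤ M * M ^ 2 * δ ^ 2 := by
    gcongr; exact hR.norm_wDagger_le x y
  have p1 := mul_le_mul_of_nonneg_right (hR.pow_le (show 1 ≤ 7 by norm_num)) (sq_nonneg δ)
  have p3 := mul_le_mul_of_nonneg_right (hR.pow_le (show 3 ≤ 7 by norm_num)) (sq_nonneg δ)
  rw [pow_one] at p1
  rw [inner_sub_left] at h2
  rw [inner_sub_right] at h3
  simp only [correctedObjective]
  rw [inner_add_left]
  linarith

/-- Compare with a minimizer `v` at the new point `x'`: the first-order terms cancel up to M‖y -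
v‖‖x' - x‖. Young's inequality and the error bound leave θ/2 times the new residual, absorbed on the
left since (1 + θ)(1 - θ/2) ≥ 1. No derivative of g* is needed. -/
theorem resY_x_step_le {θ : ℝ} (hθ : 0 < θ) (hθ1 : θ ≤ 1) (x x' : E dx) (y : E dy) :
    resY g x' y ≤ (1 + θ) * resY g x y + 5 * M ^ 3 / θ * ‖x' - x‖ ^ 2 := by
  have hM := hR.pos
  obtain ⟨v, hv, -, hyv⟩ := hR.error_bound x' y
  set δ := ‖x' - x‖ with hδ
  set e := ‖y - v‖ with he
  have h1 : valueFn g x' = g x' v :=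
    le_antisymm (ciInf_le (hR.bddBelow x') v) (le_ciInf hv)
  have h2 : valueFn g x ≤ g x v := ciInf_le (hR.bddBelow x) v
  have h3 := (abs_le.1 (hR.g_taylor_x x x' y)).2
  have h4 := (abs_le.1 (hR.g_taylor_x x x' v)).1
  have h5 : inner ℝ (gradX g x y - gradX g x v) (x' - x) ≤ M * e * δ := by
    refine (real_inner_le_norm _ _).trans ?_
    gcongr; exact hR.gradX_g_lip x y v
  rw [inner_sub_left] at h5
  have h6 : M * e * δ ≤ θ / (2 * M) * e ^ 2 + M ^ 3 / (2 * θ) * δ ^ 2 := by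
    have : 0 ≤ (θ * e - M ^ 2 * δ) ^ 2 / (2 * M * θ) := by positivity
    have e1 : (θ * e - M ^ 2 * δ) ^ 2 / (2 * M * θ)
        = θ / (2 * M) * e ^ 2 + M ^ 3 / (2 * θ) * δ ^ 2 - M * e * δ := by
      field_simp; ring
    linarith
  have h7 : θ / (2 * M) * e ^ 2 ≤ θ / 2 * resY g x' y := by
    calc _ ≤ θ / (2 * M) * (M * resY g x' y) := by gcongr
      _ = _ := by field_simp
  have h8 : (1 - θ / 2) * resY g x' y ≤ resY g x y + (M ^ 3 / (2 * θ) + 2 * M) * δ ^ 2 := by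
    have ea : resY g x' y = g x' y - g x' v := by rw [resY, h1]
    have eb : g x y - g x v ≤ resY g x y := by rw [resY]; linarith
    rw [sub_mul, one_mul]; linarith
  have h9 : M ^ 3 / (2 * θ) + 2 * M ≤ 5 / 2 * M ^ 3 / θ := by
    have p1 := hR.pow_le (show 1 ≤ 3 by norm_num)
    have : M ≤ M ^ 3 / θ := by
      rw [le_div_iff₀ hθ]; rw [pow_one] at p1
      exact (mul_le_of_le_one_right hM.le hθ1).trans p1
    have e1 : M ^ 3 / (2 * θ) = 1 / 2 * (M ^ 3 / θ) := by field_simp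
    have e2 : 5 / 2 * M ^ 3 / θ = 5 / 2 * (M ^ 3 / θ) := by ring
    rw [e1, e2]; linarith
  have hr0 := hR.resY_nonneg x y
  have hr1 := hR.resY_nonneg x' y
  have hθ2 : 1 ≤ (1 + θ) * (1 - θ / 2) := by nlinarith
  calc resY g x' y ≤ (1 + θ) * (1 - θ / 2) * resY g x' y := le_mul_of_one_le_left hr1 hθ2
    _ = (1 + θ) * ((1 - θ / 2) * resY g x' y) := by ring
    _ ≤ (1 + θ) * (resY g x y + (5 / 2 * M ^ 3 / θ) * δ ^ 2) := by
        gcongr; exact h8.trans (by gcongr)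
    _ = (1 + θ) * resY g x y + (1 + θ) * ((5 / 2 * M ^ 3 / θ) * δ ^ 2) := by ring
    _ ≤ (1 + θ) * resY g x y + 2 * ((5 / 2 * M ^ 3 / θ) * δ ^ 2) := by gcongr; linarith
    _ = _ := by ring

/-- The budget: of 16M⁷β‖∇_y g‖², the bounds `t1` and `t3` use 4 parts each and leave 8. Of the 7/8
in `hDd`, the bounds `t1`, `t2` and `t4` use 1/8 each and leave 1/2. -/
theorem lyapunov_outer_le {α β : ℝ} (hβ : 0 < β) (hβM : 2 * M * β ≤ 1) (hα : 0 < α)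
    (hαβ : 40960 * M ^ 11 * α ≤ β) {N : ℕ} (hN : 1 ≤ N) (x : E dx) (y w : E dy) {d : E dx}
    (hd : d = gradX f x (innerY g β N x y) + hessXY g x (innerY g β N x y) w) :
    lyapunov M f g P (x - α • d) (innerY g β N x y) ≤ lyapunov M f g P x y - α / 2 * ‖d‖ ^ 2
      - 8 * M ^ 7 * β * ‖gradY g x y‖ ^ 2
      + 2 * α * M ^ 2 * ‖w - wDagger f P x (innerY g β N x y)‖ ^ 2 := by
  have hM := hR.pos
  have hM1 := hR.one_le
  have hβ1 : β ≤ 1 := by nlinarith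
  set z := innerY g β N x y
  set D := gradX f x z + hessXY g x z (wDagger f P x z) with hD
  set b := ‖w - wDagger f P x z‖
  set G := ‖gradY g x y‖
  have hδ : ‖(x - α • d) - x‖ = α * ‖d‖ := by
    rw [sub_sub_cancel_left, norm_neg, norm_smul, Real.norm_of_nonneg hα.le]
  have hz := (hR.innerY_descent hβ hβM x N y).2
  have hzG : resY g x z ≤ M * G ^ 2 := hz.trans (hR.pl x y)
  have hg1 : ‖gradY g x z‖ ^ 2 ≤ 4 * M ^ 2 * G ^ 2 := by
    calc _ ≤ 4 * M * resY g x z := hR.norm_sq_gradY_le x z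
      _ ≤ 4 * M * (M * G ^ 2) := by gcongr
      _ = _ := by ring
  have h1 := hR.lyapunov_innerY_le hβ hβM hN x y
  have h2 := hR.correctedObjective_x_step_le x (x - α • d) z
  rw [hδ, sub_sub_cancel_left, inner_neg_right, inner_smul_right] at h2
  -- This θ makes the growth 64M⁷θ(g - g*) at most 4M⁷β‖∇_y g‖². The price 1/θ on the x-displacement
  -- forces α to be small relative to β.
  have h3 := hR.resY_x_step_le (θ := β / (16 * M)) (by positivity)
    (by rw [div_le_one (by positivity)]; linarith) x (x - α • d) z
  rw [hδ] at h3
  have h3' := mul_le_mul_of_nonneg_left h3 (show 0 ≤ 64 * M ^ 7 by positivity)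
  have hDd : -(α * inner ℝ D d) ≤ -(7 / 8 * α * ‖d‖ ^ 2) + 2 * α * M ^ 2 * b ^ 2 := by
    have e1 : inner ℝ D d = ‖d‖ ^ 2 - inner ℝ (d - D) d := by
      rw [inner_sub_left, real_inner_self_eq_norm_sq]; ring
    have e2 : inner ℝ (d - D) d ≤ M * b * ‖d‖ := by
      refine (real_inner_le_norm _ _).trans ?_
      gcongr
      have : d - D = hessXY g x z (w - wDagger f P x z) := by rw [hd, hD, map_sub]; abel
      rw [this]
      exact ContinuousLinearMap.le_of_opNorm_le _ (hR.hessXY_le x z) _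
    have e3 : M * b * ‖d‖ ≤ 1 / 8 * ‖d‖ ^ 2 + 2 * M ^ 2 * b ^ 2 := by
      nlinarith [sq_nonneg (‖d‖ - 4 * M * b)]
    have e4 : -inner ℝ D d ≤ -(7 / 8 * ‖d‖ ^ 2) + 2 * M ^ 2 * b ^ 2 := by linarith
    have := mul_le_mul_of_nonneg_left e4 hα.le
    linarith
  have hα7 : 72 * M ^ 7 * α ≤ β := by
    refine le_trans ?_ hαβ
    gcongr ?_ * ?_ * _
    · norm_num
    · exact hR.pow_le (by norm_num)
  have t1 : 6 * M ^ 6 * (‖gradY g x z‖ * (α * ‖d‖))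
      ≤ 1 / 8 * α * ‖d‖ ^ 2 + 4 * M ^ 7 * β * G ^ 2 := by
    have a1 : 6 * M ^ 6 * (‖gradY g x z‖ * ‖d‖)
        ≤ 1 / 8 * ‖d‖ ^ 2 + 72 * M ^ 12 * ‖gradY g x z‖ ^ 2 := by
      have e : M ^ 12 = M ^ 6 * M ^ 6 := by ring
      rw [e]
      nlinarith [sq_nonneg (‖d‖ - 24 * M ^ 6 * ‖gradY g x z‖)]
    have a2 : 72 * M ^ 12 * ‖gradY g x z‖ ^ 2 ≤ 72 * M ^ 12 * (4 * M ^ 2 * G ^ 2) := by gcongr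
    have a3 : α * (72 * M ^ 12 * (4 * M ^ 2 * G ^ 2)) = (72 * M ^ 7 * α) * (4 * M ^ 7 * G ^ 2) := by
      ring
    have a4 : (72 * M ^ 7 * α) * (4 * M ^ 7 * G ^ 2) ≤ β * (4 * M ^ 7 * G ^ 2) := by gcongr
    have a5 := mul_le_mul_of_nonneg_left (a1.trans (add_le_add_right a2 _)) hα.le
    linarith
  have t2 : 8 * M ^ 7 * (α * ‖d‖) ^ 2 ≤ 1 / 8 * α * ‖d‖ ^ 2 := by
    have : 72 * M ^ 7 * α * (α * ‖d‖ ^ 2) ≤ 1 * (α * ‖d‖ ^ 2) := by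
      gcongr; exact hα7.trans hβ1
    have h0 : 0 ≤ M ^ 7 * α * (α * ‖d‖ ^ 2) := by positivity
    have e : 8 * M ^ 7 * (α * ‖d‖) ^ 2 = 8 * (M ^ 7 * α * (α * ‖d‖ ^ 2)) := by ring
    linarith
  have t3 : 64 * M ^ 7 * (β / (16 * M) * resY g x z) ≤ 4 * M ^ 7 * β * G ^ 2 := by
    calc _ ≤ 64 * M ^ 7 * (β / (16 * M) * (M * G ^ 2)) := by gcongr
      _ = _ := by field_simp; ring
  -- The step-size constant comes from here: 40960 = 64 · 5 · 16 · 8.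
  have t4 : 64 * M ^ 7 * (5 * M ^ 3 / (β / (16 * M)) * (α * ‖d‖) ^ 2) ≤ 1 / 8 * α * ‖d‖ ^ 2 := by
    have e : 64 * M ^ 7 * (5 * M ^ 3 / (β / (16 * M)) * (α * ‖d‖) ^ 2)
        = (40960 * M ^ 11 * α) / β * (1 / 8 * α * ‖d‖ ^ 2) := by
      field_simp; ring
    rw [e]
    exact mul_le_of_le_one_left (by positivity) (by rwa [div_le_one hβ])
  simp only [lyapunov] at h1 ⊢
  linarith

/-- The objective is bounded below only on S(x). Passing to a nearby minimizer and discarding the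
correction costs, by Young's inequality, a constant plus 5M(g - g*), which the weighted residual
covers. -/
theorem le_lyapunov {fLow : ℝ} (hlow : ∀ x, ∀ y ∈ solSet g x, fLow ≤ f x y) (x : E dx) (y : E dy) :
    fLow - 2 * M ^ 4 ≤ lyapunov M f g P x y := by
  have hM := hR.pos
  obtain ⟨v, hv, -, hyv⟩ := hR.error_bound x y
  have h1 := hlow x v hv
  have h2 := hR.f_lip x v y
  rw [norm_sub_rev] at h2
  have h3 : M * ‖y - v‖ ≤ M ^ 2 + ‖y - v‖ ^ 2 := by
    nlinarith [sq_nonneg (M - ‖y - v‖), sq_nonneg M, sq_nonneg ‖y - v‖]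
  have h4 : -(M ^ 2 * ‖gradY g x y‖) ≤ inner ℝ (wDagger f P x y) (gradY g x y) := by
    refine (abs_le.1 ((abs_real_inner_le_norm _ _).trans ?_)).1
    gcongr; exact hR.norm_wDagger_le x y
  have h5 : M ^ 2 * ‖gradY g x y‖ ≤ M ^ 4 + ‖gradY g x y‖ ^ 2 := by
    nlinarith [sq_nonneg (M ^ 2 - ‖gradY g x y‖), sq_nonneg (M ^ 2), sq_nonneg ‖gradY g x y‖]
  have h6 := hR.norm_sq_gradY_le x y
  have hr := hR.resY_nonneg x y
  have p1 := mul_le_mul_of_nonneg_right (hR.pow_le (show 1 ≤ 7 by norm_num)) hr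
  have p2 := hR.pow_le (show 2 ≤ 4 by norm_num)
  rw [pow_one] at p1
  have p0 : 0 ≤ M ^ 7 * resY g x y := by positivity
  simp only [lyapunov, correctedObjective]
  linarith

theorem lyapunov_le (x : E dx) (y : E dy) :
    lyapunov M f g P x y ≤ f x y + M ^ 4 + 68 * M ^ 7 * resY g x y := by
  have hM := hR.pos
  have h4 : inner ℝ (wDagger f P x y) (gradY g x y) ≤ M ^ 2 * ‖gradY g x y‖ := by
    refine (real_inner_le_norm _ _).trans ?_
    gcongr; exact hR.norm_wDagger_le x y
  have h5 : M ^ 2 * ‖gradY g x y‖ ≤ M ^ 4 + ‖gradY g x y‖ ^ 2 := by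
    nlinarith [sq_nonneg (M ^ 2 - ‖gradY g x y‖), sq_nonneg (M ^ 2), sq_nonneg ‖gradY g x y‖]
  have h6 := hR.norm_sq_gradY_le x y
  have p1 := mul_le_mul_of_nonneg_right (hR.pow_le (show 1 ≤ 7 by norm_num)) (hR.resY_nonneg x y)
  rw [pow_one] at p1
  simp only [lyapunov, correctedObjective]
  linarith

theorem norm_sq_innerW_sub_le {ρ : ℝ} (hρ : 0 < ρ) (hρM : ρ * M ^ 2 ≤ 1) (T : ℕ) (x : E dx)
    (y : E dy) :
    ‖innerW f g ρ T x y - wDagger f P x y‖ ^ 2 ≤ Real.exp (-(ρ / M ^ 2 * T)) * M ^ 4 := by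
  have h1 := (hR.pinv x y).norm_sq_iterate_add_le (hR.hessYY_symm x y) hR.one_le
    (hR.hessYY_le x y) (hR.pinv_le x y) hρ hρM (gradY f x y) T
  have h2 := hR.norm_wDagger_le x y
  rw [wDagger, norm_neg] at h2
  rw [wDagger, sub_neg_eq_add]
  refine h1.trans ?_
  rw [show M ^ 4 = (M ^ 2) ^ 2 by ring]
  gcongr

theorem norm_innerW_le {ρ : ℝ} (hρ : 0 < ρ) (hρM : ρ * M ^ 2 ≤ 1) (T : ℕ) (x : E dx)
    (y : E dy) : ‖innerW f g ρ T x y‖ ≤ 2 * M ^ 2 := by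
  have hM := hR.pos
  have h1 : ‖innerW f g ρ T x y - wDagger f P x y‖ ≤ M ^ 2 := by
    refine le_of_sq_le_sq ((hR.norm_sq_innerW_sub_le hρ hρM T x y).trans ?_) (by positivity)
    rw [← pow_mul]
    refine mul_le_of_le_one_left (by positivity) (Real.exp_le_one_iff.2 ?_)
    rw [neg_nonpos]; positivity
  have h2 : ‖innerW f g ρ T x y‖ ≤ ‖wDagger f P x y‖ + ‖innerW f g ρ T x y - wDagger f P x y‖ :=
    norm_le_insert' _ _
  linarith [hR.norm_wDagger_le x y]

/-- An iterate pairs the new x with y and w computed at the old x. Moving x changes the residual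
vector by a multiple of the displacement, because `w` is bounded uniformly in T. -/
theorem resX_shift_le {x x' : E dx} {y w : E dy} (hw : ‖w‖ ≤ 2 * M ^ 2)
    (hx : ‖x' - x‖ ≤ ‖gradX f x y + hessXY g x y w‖) :
    resX f g x' y w ≤ 16 * M ^ 6 * ‖gradX f x y + hessXY g x y w‖ ^ 2 := by
  have hM := hR.pos
  set d := gradX f x y + hessXY g x y w with hd
  have e : gradX f x' y + hessXY g x' y w
      = d + (gradX f x' y - gradX f x y) + (hessXY g x' y - hessXY g x y) w := by
    rw [hd, _root_.sub_apply]; abel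
  have p0 := mul_le_mul_of_nonneg_right (hR.pow_le (show 0 ≤ 3 by norm_num)) (norm_nonneg d)
  have p1 := mul_le_mul_of_nonneg_right (hR.pow_le (show 1 ≤ 3 by norm_num)) (norm_nonneg d)
  have : ‖gradX f x' y + hessXY g x' y w‖ ≤ 4 * M ^ 3 * ‖d‖ := by
    rw [e]
    calc _ ≤ ‖d‖ + M * ‖d‖ + M * ‖d‖ * (2 * M ^ 2) := by
          refine norm_add_le_of_le (norm_add_le_of_le le_rfl ?_) ?_
          · exact (hR.gradX_f_lip x' x y).trans (by gcongr)
          · refine ContinuousLinearMap.le_of_opNorm_le_of_le _ ?_ hw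
            exact (hR.hessXY_lip x' x y).trans (by gcongr)
      _ = M ^ 0 * ‖d‖ + M ^ 1 * ‖d‖ + 2 * (M ^ 3 * ‖d‖) := by ring
      _ ≤ _ := by linarith
  rw [resX]
  calc _ ≤ (4 * M ^ 3 * ‖d‖) ^ 2 := by gcongr
    _ = _ := by ring

/-- At the old x the residual vector is H²(w - w†) by the normal equation; the rest is the cost of
moving x. -/
theorem resW_shift_le {x x' : E dx} {y w : E dy} {r : ℝ} (hw : ‖w‖ ≤ 2 * M ^ 2)
    (hx : ‖x' - x‖ ≤ r) :
    resW f g x' y w ≤ 2 * M ^ 4 * ‖w - wDagger f P x y‖ ^ 2 + 72 * M ^ 8 * r ^ 2 := by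
  have hM := hR.pos
  have hr : 0 ≤ r := (norm_nonneg _).trans hx
  set b := ‖w - wDagger f P x y‖
  set v := gradY f x y + hessYY g x y w with hv
  set v' := gradY f x' y + hessYY g x' y w with hv'
  have p1 := hR.pow_le (show 1 ≤ 3 by norm_num)
  have hvn : ‖v‖ ≤ 3 * M ^ 3 := by
    calc ‖v‖ ≤ M + M * (2 * M ^ 2) := norm_add_le_of_le (hR.gradY_f_le x y)
          (ContinuousLinearMap.le_of_opNorm_le_of_le _ (hR.hessYY_le x y) hw)
      _ = M ^ 1 + 2 * M ^ 3 := by ring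
      _ ≤ _ := by linarith
  have hHv : ‖hessYY g x y v‖ ≤ M ^ 2 * b := by
    have : hessYY g x y v = hessYY g x y (hessYY g x y (w - wDagger f P x y)) := by
      rw [hv, map_add, hR.hessYY_gradY_eq, map_sub, map_sub]; abel
    rw [this]
    calc _ ≤ M * (M * b) := ContinuousLinearMap.le_of_opNorm_le_of_le _ (hR.hessYY_le x y)
          (ContinuousLinearMap.le_of_opNorm_le _ (hR.hessYY_le x y) _)
      _ = _ := by ring
  have hvv : ‖v' - v‖ ≤ 3 * M ^ 3 * r := by
    have e : v' - v = (gradY f x' y - gradY f x y) + (hessYY g x' y - hessYY g x y) w := by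
      rw [hv, hv', _root_.sub_apply]; abel
    have p1' := mul_le_mul_of_nonneg_right p1 hr
    rw [e]
    calc _ ≤ M * r + M * r * (2 * M ^ 2) := by
          refine norm_add_le_of_le ((hR.gradY_f_lip_x x' x y).trans (by gcongr)) ?_
          refine ContinuousLinearMap.le_of_opNorm_le_of_le _ ?_ hw
          exact (hR.hessYY_lip_x x' x y).trans (by gcongr)
      _ = M ^ 1 * r + 2 * (M ^ 3 * r) := by ring
      _ ≤ _ := by linarith
  have hmain : ‖hessYY g x' y v'‖ ≤ M ^ 2 * b + 6 * M ^ 4 * r := by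
    have e : hessYY g x' y v'
        = hessYY g x y v + (hessYY g x' y - hessYY g x y) v + hessYY g x' y (v' - v) := by
      rw [_root_.sub_apply, map_sub]; abel
    rw [e]
    calc _ ≤ M ^ 2 * b + M * r * (3 * M ^ 3) + M * (3 * M ^ 3 * r) := by
          refine norm_add_le_of_le (norm_add_le_of_le hHv ?_) ?_
          · refine ContinuousLinearMap.le_of_opNorm_le_of_le _ ?_ hvn
            exact (hR.hessYY_lip_x x' x y).trans (by gcongr)
          · exact ContinuousLinearMap.le_of_opNorm_le_of_le _ (hR.hessYY_le x' y) hvv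
      _ = _ := by ring
  rw [resW]
  calc _ ≤ (M ^ 2 * b + 6 * M ^ 4 * r) ^ 2 := by gcongr
    _ ≤ 2 * ((M ^ 2 * b) ^ 2 + (6 * M ^ 4 * r) ^ 2) := add_sq_le
    _ = _ := by ring

end Regularity

end Descent

/-! ### Summation over the iterations and step counting. -/

section Rates

/-- A bound for the total decrease of the Lyapunov function. -/
def decreaseBound (M α D : ℝ) : ℝ := D + 3 * M ^ 4 + 68 * M ^ 7 * D + 2 * α * M ^ 6

/-- A bound for the sum of each of the three residuals along the iterates. -/
def residualBound (M α β D : ℝ) : ℝ :=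
  D + 2 * M ^ 8 + 72 * M ^ 8 * (2 / α * decreaseBound M α D)
    + M * (1 / (8 * M ^ 7 * β) * decreaseBound M α D)

/-- Each linear-system error is O(1/K), so K of them sum to O(1). -/
theorem mul_exp_innerSteps_le_one {c r : ℝ} (hr : 0 < r) (hc : 1 / r ≤ c) {K : ℕ} (hK : 1 ≤ K) :
    K * Real.exp (-(r * innerSteps c K)) ≤ 1 := by
  have hK0 : (0 : ℝ) < K := by exact_mod_cast hK
  have hlog : 0 ≤ Real.log K := Real.log_natCast_nonneg K
  have h1 : c * Real.log K ≤ innerSteps c K := Nat.le_ceil _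
  have h2 : 1 ≤ r * c := by rwa [div_le_iff₀ hr, mul_comm] at hc
  have h3 : Real.log K ≤ r * innerSteps c K := by
    calc Real.log K ≤ r * c * Real.log K := le_mul_of_one_le_left hlog h2
      _ = r * (c * Real.log K) := by ring
      _ ≤ _ := by gcongr
  calc K * Real.exp (-(r * innerSteps c K)) ≤ K * Real.exp (-Real.log K) := by gcongr
    _ = 1 := by rw [Real.exp_neg, Real.exp_log hK0, mul_inv_cancel₀ hK0.ne']

/-- Iteration k controls the residuals at index k + 1; index 0 is left to the initial data. -/
theorem sum_range_le_add_of_succ_le {a b : ℕ → ℝ} (hb : ∀ k, 0 ≤ b k)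
    (h : ∀ k, a (k + 1) ≤ b k) (K : ℕ) :
    ∑ k ∈ Finset.range K, a k ≤ max (a 0) 0 + ∑ k ∈ Finset.range K, b k := by
  cases K with
  | zero => simp
  | succ K =>
    rw [Finset.sum_range_succ', add_comm (∑ k ∈ Finset.range K, a (k + 1))]
    refine add_le_add (le_max_left _ _) ?_
    rw [Finset.sum_range_succ]
    have := Finset.sum_le_sum fun k (_ : k ∈ Finset.range K) => h k
    linarith [hb K]

variable {dx dy : ℕ} {M : ℝ} {f g : E dx → E dy → ℝ} {P : E dx → E dy → E dy →L[ℝ] E dy}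

theorem Regularity.sum_residuals_le (hR : Regularity M f g P) {α β ρ : ℝ} {N : ℕ} (hN : 1 ≤ N)
    (hβ : 0 < β) (hβM : 2 * M * β ≤ 1) (hα : 0 < α) (hαβ : 40960 * M ^ 11 * α ≤ β) (hρ : 0 < ρ)
    (hρM : ρ * M ^ 2 ≤ 1) {c : ℝ} (hc : 1 / (ρ / M ^ 2) ≤ c) {s₀ : State dx dy} {fLow D : ℝ}
    (hlow : ∀ x, ∀ y ∈ solSet g x, fLow ≤ f x y) (h0 : f s₀.x s₀.y - fLow ≤ D)
    (hx0 : resX f g s₀.x s₀.y s₀.w ≤ D) (hw0 : resW f g s₀.x s₀.y s₀.w ≤ D)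
    (hy0 : resY g s₀.x s₀.y ≤ D) {K : ℕ} (hK : 1 ≤ K) :
    let z := iter f g α β ρ N (innerSteps c K) s₀
    ∑ k ∈ Finset.range K, resX f g (z k).x (z k).y (z k).w ≤ residualBound M α β D ∧
    ∑ k ∈ Finset.range K, resW f g (z k).x (z k).y (z k).w ≤ residualBound M α β D ∧
    ∑ k ∈ Finset.range K, resY g (z k).x (z k).y ≤ residualBound M α β D := by
  intro z
  have hM := hR.pos
  have hM1 := hR.one_le
  have hD : 0 ≤ D := (hR.resY_nonneg _ _).trans hy0
  have hα1 : α ≤ 1 := by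
    have h1 : (1 : ℝ) ≤ M ^ 11 := one_le_pow₀ hM1
    have h2 : β ≤ 1 := by nlinarith
    nlinarith
  have hstep : ∀ k, z (k + 1) = step f g α β ρ N (innerSteps c K) (z k) := fun k =>
    Function.iterate_succ_apply' _ _ _
  set d : ℕ → E dx := fun k => gradX f (z k).x (z (k + 1)).y
    + hessXY g (z k).x (z (k + 1)).y (z (k + 1)).w with hd
  have hzx : ∀ k, (z (k + 1)).x = (z k).x - α • d k := fun k => by simp only [hd, hstep k]; rfl
  have hzy : ∀ k, (z (k + 1)).y = innerY g β N (z k).x (z k).y := fun k => by rw [hstep k]; rfl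
  have hzw : ∀ k, (z (k + 1)).w = innerW f g ρ (innerSteps c K) (z k).x (z (k + 1)).y := fun k => by
    rw [hstep k]; rfl
  have hδ : ∀ k, ‖(z (k + 1)).x - (z k).x‖ ≤ ‖d k‖ := fun k => by
    rw [hzx, sub_sub_cancel_left, norm_neg, norm_smul, Real.norm_of_nonneg hα.le]
    exact mul_le_of_le_one_left (norm_nonneg _) hα1
  set b : ℕ → ℝ := fun k => ‖(z (k + 1)).w - wDagger f P (z k).x (z (k + 1)).y‖ ^ 2 with hb
  have hsb : ∑ k ∈ Finset.range K, b k ≤ M ^ 4 := by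
    have hbk : ∀ k ∈ Finset.range K,
        b k ≤ Real.exp (-(ρ / M ^ 2 * innerSteps c K)) * M ^ 4 := fun k _ => by
      simp only [hb, hzw]
      exact hR.norm_sq_innerW_sub_le hρ hρM _ _ _
    refine (Finset.sum_le_card_nsmul _ _ _ hbk).trans ?_
    rw [Finset.card_range, nsmul_eq_mul, ← mul_assoc]
    exact mul_le_of_le_one_left (by positivity)
      (mul_exp_innerSteps_le_one (by positivity) hc hK)
  have hb0 : ∀ k, 0 ≤ b k := fun k => sq_nonneg _
  set v : ℕ → ℝ := fun k => lyapunov M f g P (z k).x (z k).y with hv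
  set G : ℕ → ℝ := fun k => ‖gradY g (z k).x (z k).y‖ ^ 2 with hG
  have hdesc : ∀ k, α / 2 * ‖d k‖ ^ 2 + 8 * M ^ 7 * β * G k
      ≤ (v k - v (k + 1)) + 2 * α * M ^ 2 * b k := fun k => by
    have := hR.lyapunov_outer_le hβ hβM hα hαβ hN (z k).x (z k).y (z (k + 1)).w (d := d k)
      (by simp only [hd, hzy])
    rw [← hzy, ← hzx] at this
    simp only [hv, hG, hb]
    linarith
  have hv0 : v 0 ≤ fLow + D + M ^ 4 + 68 * M ^ 7 * D := by
    have h1 := hR.lyapunov_le s₀.x s₀.y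
    have h2 : 68 * M ^ 7 * resY g s₀.x s₀.y ≤ 68 * M ^ 7 * D := by gcongr
    change lyapunov M f g P s₀.x s₀.y ≤ _
    linarith
  have hvK : fLow - 2 * M ^ 4 ≤ v K := hR.le_lyapunov hlow _ _
  have htot : α / 2 * ∑ k ∈ Finset.range K, ‖d k‖ ^ 2
      + 8 * M ^ 7 * β * ∑ k ∈ Finset.range K, G k ≤ decreaseBound M α D := by
    have h1 := Finset.sum_le_sum fun k (_ : k ∈ Finset.range K) => hdesc k
    rw [Finset.sum_add_distrib, Finset.sum_add_distrib, Finset.sum_range_sub',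
      ← Finset.mul_sum, ← Finset.mul_sum, ← Finset.mul_sum] at h1
    have h2 : 2 * α * M ^ 2 * ∑ k ∈ Finset.range K, b k ≤ 2 * α * M ^ 2 * M ^ 4 := by gcongr
    rw [decreaseBound]
    linarith
  have hdsum0 : 0 ≤ ∑ k ∈ Finset.range K, ‖d k‖ ^ 2 := by positivity
  have hGsum0 : 0 ≤ ∑ k ∈ Finset.range K, G k := Finset.sum_nonneg fun k _ => sq_nonneg _
  have hdsum : ∑ k ∈ Finset.range K, ‖d k‖ ^ 2 ≤ 2 / α * decreaseBound M α D := by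
    have h1 : α / 2 * ∑ k ∈ Finset.range K, ‖d k‖ ^ 2 ≤ decreaseBound M α D :=
      le_trans (le_add_of_nonneg_right (by positivity)) htot
    calc _ = 2 / α * (α / 2 * ∑ k ∈ Finset.range K, ‖d k‖ ^ 2) := by field_simp
      _ ≤ _ := by gcongr
  have hGsum : ∑ k ∈ Finset.range K, G k ≤ 1 / (8 * M ^ 7 * β) * decreaseBound M α D := by
    have h1 : 8 * M ^ 7 * β * ∑ k ∈ Finset.range K, G k ≤ decreaseBound M α D :=
      le_trans (le_add_of_nonneg_left (by positivity)) htot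
    calc _ = 1 / (8 * M ^ 7 * β) * (8 * M ^ 7 * β * ∑ k ∈ Finset.range K, G k) := by field_simp
      _ ≤ _ := by gcongr
  have hA : 0 ≤ 2 / α * decreaseBound M α D := hdsum0.trans hdsum
  have hB : 0 ≤ M * (1 / (8 * M ^ 7 * β) * decreaseBound M α D) :=
    mul_nonneg hM.le (hGsum0.trans hGsum)
  have hwb : ∀ k, ‖(z (k + 1)).w‖ ≤ 2 * M ^ 2 := fun k => by
    rw [hzw]; exact hR.norm_innerW_le hρ hρM _ _ _
  have hM8 : (0 : ℝ) ≤ M ^ 8 := by positivity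
  rw [residualBound]
  refine ⟨?_, ?_, ?_⟩
  · have h1 := sum_range_le_add_of_succ_le (a := fun k => resX f g (z k).x (z k).y (z k).w)
      (b := fun k => 16 * M ^ 6 * ‖d k‖ ^ 2) (fun k => by positivity)
      (fun k => hR.resX_shift_le (hwb k) (hδ k)) K
    rw [← Finset.mul_sum] at h1
    have h2 : max (resX f g (z 0).x (z 0).y (z 0).w) 0 ≤ D := max_le hx0 hD
    have h3 : 16 * M ^ 6 * ∑ k ∈ Finset.range K, ‖d k‖ ^ 2
        ≤ 72 * M ^ 8 * (2 / α * decreaseBound M α D) := by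
      have := hR.pow_le (show 6 ≤ 8 by norm_num)
      gcongr
      norm_num
    linarith
  · have h1 := sum_range_le_add_of_succ_le (a := fun k => resW f g (z k).x (z k).y (z k).w)
      (b := fun k => 2 * M ^ 4 * b k + 72 * M ^ 8 * ‖d k‖ ^ 2)
      (fun k => by have := hb0 k; positivity)
      (fun k => hR.resW_shift_le (hwb k) (hδ k)) K
    rw [Finset.sum_add_distrib, ← Finset.mul_sum, ← Finset.mul_sum] at h1
    have h2 : max (resW f g (z 0).x (z 0).y (z 0).w) 0 ≤ D := max_le hw0 hD
    have h3 : 72 * M ^ 8 * ∑ k ∈ Finset.range K, ‖d k‖ ^ 2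
        ≤ 72 * M ^ 8 * (2 / α * decreaseBound M α D) := by gcongr
    have h4 : 2 * M ^ 4 * ∑ k ∈ Finset.range K, b k ≤ 2 * M ^ 4 * M ^ 4 := by gcongr
    linarith
  -- No index shift here: `G k` is taken at the k-th iterate itself and PL applies directly.
  · have h1 : ∑ k ∈ Finset.range K, resY g (z k).x (z k).y ≤ M * ∑ k ∈ Finset.range K, G k := by
      rw [Finset.mul_sum]; exact Finset.sum_le_sum fun k _ => hR.pl _ _
    have h2 : M * ∑ k ∈ Finset.range K, G k
        ≤ M * (1 / (8 * M ^ 7 * β) * decreaseBound M α D) := by gcongr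
    have h3 : 0 ≤ 72 * M ^ 8 * (2 / α * decreaseBound M α D) := by positivity
    linarith

/-- Some iterate attains at most the average of the three residuals. -/
theorem exists_isEpsStationary {z : ℕ → State dx dy} (hbdd : ∀ x, BddBelow (Set.range (g x)))
    {S ε : ℝ} {K : ℕ} (hK : 1 ≤ K) (hS : 3 * S ≤ K * ε)
    (hx : ∑ k ∈ Finset.range K, resX f g (z k).x (z k).y (z k).w ≤ S)
    (hw : ∑ k ∈ Finset.range K, resW f g (z k).x (z k).y (z k).w ≤ S)
    (hy : ∑ k ∈ Finset.range K, resY g (z k).x (z k).y ≤ S) :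
    ∃ k < K, IsEpsStationary f g ε (z k).x (z k).y := by
  -- Averaging the sum of the three residuals makes one index serve for all of them, at the cost of
  -- the factor 3.
  have h : ∑ k ∈ Finset.range K, (resX f g (z k).x (z k).y (z k).w
      + resW f g (z k).x (z k).y (z k).w + resY g (z k).x (z k).y)
      ≤ ∑ _k ∈ Finset.range K, ε := by
    rw [Finset.sum_add_distrib, Finset.sum_add_distrib, Finset.sum_const, Finset.card_range,
      nsmul_eq_mul]
    linarith
  obtain ⟨k, hk, hle⟩ := Finset.exists_le_of_sum_le
    (Finset.nonempty_range_iff.2 (Nat.one_le_iff_ne_zero.1 hK)) h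
  have h1 : 0 ≤ resX f g (z k).x (z k).y (z k).w := sq_nonneg _
  have h2 : 0 ≤ resW f g (z k).x (z k).y (z k).w := sq_nonneg _
  have h3 : 0 ≤ resY g (z k).x (z k).y := sub_nonneg.2 (ciInf_le (hbdd _) _)
  exact ⟨k, Finset.mem_range.1 hk, (z k).w, by linarith, by linarith, by linarith⟩

theorem total_steps_le {c S ε : ℝ} (hc : 0 ≤ c) (hS : 0 < S) (N : ℕ) (hε : 0 < ε)
    (hε2 : ε ≤ 1 / 2) :
    (⌈3 * S / ε⌉₊ : ℝ) * (N + innerSteps c ⌈3 * S / ε⌉₊ + 1)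
      ≤ (3 * S + 1) * (2 * (N + 2) + 2 * c * Real.log (3 * S + 1) + c)
        * (ε⁻¹ * Real.log ε⁻¹) := by
  set K := ⌈3 * S / ε⌉₊
  have hK0 : 0 < K := Nat.ceil_pos.2 (by positivity)
  have hK : (K : ℝ) ≤ (3 * S + 1) * ε⁻¹ := by
    have h1 : (K : ℝ) < 3 * S / ε + 1 := Nat.ceil_lt_add_one (by positivity)
    have h2 : 1 ≤ ε⁻¹ := (one_le_inv₀ hε).2 (by linarith)
    rw [div_eq_mul_inv] at h1
    linarith
  set l := Real.log ε⁻¹ with hl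
  -- The restriction ε ≤ 1/2 keeps log ε⁻¹ away from 0, so that additive constants are absorbed into
  -- it.
  have hl1 : 1 ≤ 2 * l := by
    have h1 : Real.log 2 ≤ l := by
      apply Real.log_le_log (by norm_num)
      rw [le_inv_comm₀ (by norm_num) hε]; linarith
    linarith [Real.log_two_gt_d9]
  have hlogS : 0 ≤ Real.log (3 * S + 1) := Real.log_nonneg (by linarith)
  have hlogK : Real.log K ≤ Real.log (3 * S + 1) + l := by
    rw [hl, ← Real.log_mul (by positivity) (by positivity)]
    exact Real.log_le_log (by exact_mod_cast hK0) hK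
  have hT : (innerSteps c K : ℝ) ≤ c * (Real.log (3 * S + 1) + l) + 1 := by
    have h1 : (innerSteps c K : ℝ) < c * Real.log K + 1 :=
      Nat.ceil_lt_add_one (mul_nonneg hc (Real.log_natCast_nonneg K))
    have h2 := mul_le_mul_of_nonneg_left hlogK hc
    linarith
  have hN : (0 : ℝ) ≤ N + 2 + c * Real.log (3 * S + 1) := by positivity
  have hlen : (N : ℝ) + innerSteps c K + 1
      ≤ (2 * (N + 2) + 2 * c * Real.log (3 * S + 1) + c) * l := by
    have := mul_le_mul_of_nonneg_left hl1 hN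
    linarith
  calc _ ≤ ((3 * S + 1) * ε⁻¹) * ((2 * (N + 2) + 2 * c * Real.log (3 * S + 1) + c) * l) := by
        gcongr
    _ = _ := by ring

end Rates

end Galet

end

theorem theorem2 (lf0 lf1 lg1 lg2 : ℝ≥0) (mu lam : ℝ) (hmu : 0 < mu) (hlam : 0 < lam)
    (N : ℕ) (hN : 1 ≤ N) :
    -- proper constants for the step sizes, depending only on the problem constants and `N`
    ∃ βbar > (0 : ℝ), ∃ κ > (0 : ℝ), ∃ ρbar > (0 : ℝ),
    ∀ α β ρ : ℝ, 0 < β → β ≤ βbar → 0 < α → α ≤ κ * β → 0 < ρ → ρ ≤ ρbar →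
    ∃ cbar > (0 : ℝ), ∀ c : ℝ, cbar ≤ c →
    -- `D` bounds the initial optimality gap and the initial residuals
    ∀ D : ℝ, ∃ C > (0 : ℝ),
    ∀ (dx dy : ℕ) (f g : Galet.E dx → Galet.E dy → ℝ) (s₀ : Galet.State dx dy) (fLow : ℝ),
      Galet.LipschitzAssumption lf0 lf1 lg1 lg2 f g →
      Galet.PLAssumption mu lam g →
      (∀ x, ∀ y ∈ Galet.solSet g x, fLow ≤ f x y) →
      f s₀.x s₀.y - fLow ≤ D →
      Galet.resX f g s₀.x s₀.y s₀.w ≤ D →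
      Galet.resW f g s₀.x s₀.y s₀.w ≤ D →
      Galet.resY g s₀.x s₀.y ≤ D →
      -- the `O(1/K)` rates with `T = ⌈c log K⌉`
      (∀ K : ℕ, 1 ≤ K →
        let z := Galet.iter f g α β ρ N (Galet.innerSteps c K) s₀
        (1 / (K : ℝ)) * ∑ k ∈ Finset.range K, Galet.resX f g (z k).x (z k).y (z k).w ≤ C / K ∧
        (1 / (K : ℝ)) * ∑ k ∈ Finset.range K, Galet.resW f g (z k).x (z k).y (z k).w ≤ C / K ∧
        (1 / (K : ℝ)) * ∑ k ∈ Finset.range K, Galet.resY g (z k).x (z k).y ≤ C / K) ∧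
      -- the iteration complexity, counting all `y`-, `w`- and `x`-steps
      (∀ ε : ℝ, 0 < ε → ε ≤ 1 / 2 →
        ∃ K : ℕ, 1 ≤ K ∧
          (K : ℝ) * (N + Galet.innerSteps c K + 1) ≤ C * (ε⁻¹ * Real.log ε⁻¹) ∧
          ∃ k < K,
            let z := Galet.iter f g α β ρ N (Galet.innerSteps c K) s₀ k
            Galet.IsEpsStationary f g ε z.x z.y) := by
  obtain ⟨M, hM1, hM⟩ := Galet.exists_regularity lf0 lf1 lg1 lg2 mu lam hmu hlam
  have hM0 : 0 < M := by linarith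
  refine ⟨1 / (2 * M), by positivity, 1 / (40960 * M ^ 11), by positivity, 1 / M ^ 2,
    by positivity, fun α β ρ hβ hβM hα hαβ hρ hρM => ⟨1 / (ρ / M ^ 2), by positivity,
    fun c hc D => ?_⟩⟩
  have hβM' : 2 * M * β ≤ 1 := by rwa [le_div_iff₀ (by positivity), mul_comm] at hβM
  have hαβ' : 40960 * M ^ 11 * α ≤ β := by
    rwa [one_div_mul_eq_div, le_div_iff₀ (by positivity), mul_comm] at hαβ
  have hρM' : ρ * M ^ 2 ≤ 1 := by rwa [le_div_iff₀ (by positivity)] at hρM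
  have hc0 : 0 ≤ c := le_trans (by positivity) hc
  -- `D` is an arbitrary real, so the residual bound may be negative; the maximum keeps the constant
  -- and the choice K = ⌈3S/ε⌉ positive.
  set S : ℝ := max (Galet.residualBound M α β D) 1
  have hS : 0 < S := lt_max_of_lt_right one_pos
  set B : ℝ := (3 * S + 1) * (2 * (N + 2) + 2 * c * Real.log (3 * S + 1) + c)
  have hB : 0 ≤ B := by
    have : 0 ≤ Real.log (3 * S + 1) := Real.log_nonneg (by linarith)
    positivity
  refine ⟨S + B, by positivity, fun dx dy f g s₀ fLow hL hP hlow h0 hx0 hw0 hy0 => ?_⟩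
  obtain ⟨P, hR⟩ := hM dx dy f g hL hP
  have hsum := fun {K : ℕ} (hK : 1 ≤ K) => hR.sum_residuals_le hN hβ hβM' hα hαβ' hρ hρM' hc
    hlow h0 hx0 hw0 hy0 hK
  have hSb : Galet.residualBound M α β D ≤ S := le_max_left _ _
  refine ⟨fun K hK => ?_, fun ε hε hε2 => ?_⟩
  · obtain ⟨h1, h2, h3⟩ := hsum hK
    simp only [one_div_mul_eq_div]
    refine ⟨?_, ?_, ?_⟩ <;> gcongr <;> linarith
  · have hK : 1 ≤ ⌈3 * S / ε⌉₊ := Nat.ceil_pos.2 (by positivity)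
    obtain ⟨h1, h2, h3⟩ := hsum hK
    refine ⟨⌈3 * S / ε⌉₊, hK, (Galet.total_steps_le hc0 hS N hε hε2).trans ?_, ?_⟩
    · have : 0 ≤ Real.log ε⁻¹ := Real.log_nonneg ((one_le_inv₀ hε).2 (by linarith))
      gcongr
      linarith
    · exact Galet.exists_isEpsStationary hR.bddBelow hK ((div_le_iff₀ hε).1 (Nat.le_ceil _))
        (h1.trans hSb) (h2.trans hSb) (h3.trans hSb)
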